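/- All boxes are closed axis-aligned rectangles in the plane with non-empty interior; a box covers a point if the point lies in its interior. A set $Z$ of boxes covers a set $A\subseteq\mathbb{R}^2$ exactly if the closure of $A$ equals the union of the boxes in $Z$. A rectilinear polygon is a connected set $P\subseteq\mathbb{R}^2$ such that the closure of $P$ is the union of a finite set of boxes any two of which are disjoint or meet in more than one point, and such that every connected component of $\mathbb{R}^2\setminus P$ has non-empty interior. *Simultaneous Boxes Class Cover (SBCC).* Given disjoint finite sets $R$ (red points) and $B$ (blue points) in the plane, find a smallest finite set of boxes such that every point of $R\cup B$ is covered by some box, every box covers points of at most one color, and no box covering a red point intersects the interior of a box covering a blue point. *Simultaneous Rectilinear Polygon Cover (SRPC).* Given a closed rectilinear polygon $P$ and a box $K$ containing $P$ in its interior, find finite sets $\mathcal{R}$ and $\mathcal{B}$ of boxes with $|\mathcal{R}\cup\mathcal{B}|$ smallest possible such that $\mathcal{R}$ covers $P$ exactly and $\mathcal{B}$ covers $K\setminus P$ exactly. Inputs and outputs have rational coordinates, written as binary fractions in lowest terms; finite sets are given as lists, and $P$ is given by a list of axis-parallel segments whose union is the boundary of $P$. A minimization problem can be approximated in polynomial time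 within a factor $\rho$ if some algorithm, given any instance, halts in time polynomial in the bit length of the input and outputs a feasible solution whose cardinality is at most $\rho$ times that of every feasible solution. **Theorem.** Let $\varepsilon\ge 0$. If SBCC can be approximated in polynomial time within the constant factor $1+\varepsilon$, then SRPC can also be approximated in polynomial time within the constant factor $1+\varepsilon$. -/

import Mathlib

open Set

/-! ### Polynomial time: a small programming language with logarithmic cost -/

/-- The values that programs work on: nested pairs whose atoms are integers. -/
inductive Data : Type where
  | int (n : ℤ) : Data
  | pair (a b : Data) : Data

/-- The bit size of a value: integers are counted by the length of their binary expansion. -/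
def Data.size : Data → ℕ
  | .int n => 1 + Nat.size n.natAbs
  | .pair a b => 1 + a.size + b.size

/-- The elementary operations: projections, addition, subtraction, multiplication and comparison of
two integers. -/
inductive PrimOp : Type where
  | id | fst | snd | add | sub | mul | lt

/-- The value of an elementary operation. The integer `0` stands for "false", and it is also the
result of an operation on an argument of the wrong shape. -/
def PrimOp.eval : PrimOp → Data → Data
  | .id, x => x
  | .fst, .pair a _ => a
  | .snd, .pair _ b => b
  | .add, .pair (.int m) (.int n) => .int (m + n)
  | .sub, .pair (.int m) (.int n) => .int (m - n)
  | .mul, .pair (.int m) (.int n) => .int (m * n)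
  | .lt, .pair (.int m) (.int n) => .int (if m < n then 1 else 0)
  | _, _ => .int 0

/-- Programs. A program turns the current value `x` into a new value: replace `x` by a constant;
apply an elementary operation to it; run two programs on `x` and pair the results; run one program
after the other; branch; repeat `body` as long as the test `c` gives a value different from `0`. -/
inductive Prog : Type where
  | const (c : Data) : Prog
  | prim (o : PrimOp) : Prog
  | fork (f g : Prog) : Prog
  | seq (f g : Prog) : Prog
  | ite (c f g : Prog) : Prog
  | loop (c body : Prog) : Prog

/-- `Prog.Run p x y t`: on input `x` the program `p` halts with output `y` after time `t`. Each
elementary step is charged at least the total bit size of the values that it reads and writes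
(logarithmic cost criterion), so that running times agree with those of Turing machines up to a
polynomial. -/
inductive Prog.Run : Prog → Data → Data → ℕ → Prop where
  | const (c x : Data) : Run (.const c) x c (x.size + c.size)
  | prim (o : PrimOp) (x : Data) : Run (.prim o) x (o.eval x) (x.size + (o.eval x).size)
  | fork {f g : Prog} {x y z : Data} {s t : ℕ} (hf : Run f x y s) (hg : Run g x z t) :
      Run (.fork f g) x (.pair y z) (s + t + x.size + y.size + z.size)
  | seq {f g : Prog} {x y z : Data} {s t : ℕ} (hf : Run f x y s) (hg : Run g y z t) :
      Run (.seq f g) x z (s + t + 1)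
  | ite_true {c f g : Prog} {x v y : Data} {s t : ℕ} (hc : Run c x v s) (hv : v ≠ .int 0)
      (hf : Run f x y t) : Run (.ite c f g) x y (s + t + x.size)
  | ite_false {c f g : Prog} {x y : Data} {s t : ℕ} (hc : Run c x (.int 0) s)
      (hg : Run g x y t) : Run (.ite c f g) x y (s + t + x.size)
  | loop_stop {c body : Prog} {x : Data} {s : ℕ} (hc : Run c x (.int 0) s) :
      Run (.loop c body) x x (s + x.size)
  | loop_step {c body : Prog} {x v y z : Data} {s t u : ℕ} (hc : Run c x v s)
      (hv : v ≠ .int 0) (hb : Run body x y t) (hl : Run (.loop c body) y z u) :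
      Run (.loop c body) x z (s + t + u + x.size)

/-- A minimization problem: instances, candidate solutions, their encodings (an object may have
several encodings, for instance by lists in different orders), feasibility, and the cost. -/
structure MinProblem where
  Inst : Type
  Sol : Type
  EncodesInst : Data → Inst → Prop
  EncodesSol : Data → Sol → Prop
  Feasible : Inst → Sol → Prop
  cost : Sol → ℕ

/-- There is a program which, on every encoding of every instance, halts within time polynomial in
the size of the encoding and outputs an encoding of a feasible solution whose cost is at most `ρ`
times the cost of every feasible solution. -/
def MinProblem.PolyTimeApproximable (A : MinProblem) (ρ : ℝ) : Prop :=
  ∃ (p : Prog) (q : Polynomial ℕ), ∀ (I : A.Inst) (d : Data), A.EncodesInst d I →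
    ∃ (out : Data) (t : ℕ) (s : A.Sol), p.Run d out t ∧ t ≤ q.eval d.size ∧
      A.EncodesSol out s ∧ A.Feasible I s ∧
      ∀ s' : A.Sol, A.Feasible I s' → (A.cost s : ℝ) ≤ ρ * (A.cost s' : ℝ)

/-! ### Boxes and rectilinear polygons -/

/-- Axis-aligned boxes with non-empty interior, given by their four sides. -/
structure Box (k : Type) [LT k] where
  left : k
  right : k
  bottom : k
  top : k
  left_lt_right : left < right
  bottom_lt_top : bottom < top

/-- The closed box as a subset of the plane. -/
def Box.toSet (b : Box ℝ) : Set (ℝ × ℝ) := Icc b.left b.right ×ˢ Icc b.bottom b.top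

/-- A rational box, seen as a box in the real plane. -/
noncomputable def Box.toReal (b : Box ℚ) : Box ℝ where
  left := b.left
  right := b.right
  bottom := b.bottom
  top := b.top
  left_lt_right := Rat.cast_lt.mpr b.left_lt_right
  bottom_lt_top := Rat.cast_lt.mpr b.bottom_lt_top

/-- A point with rational coordinates, seen in the real plane. -/
noncomputable def ratPoint (p : ℚ × ℚ) : ℝ × ℝ := ((p.1 : ℝ), (p.2 : ℝ))

/-- A box covers a point if the point is in the interior of the box. -/
def Box.CoversPoint (b : Box ℝ) (p : ℝ × ℝ) : Prop := p ∈ interior b.toSet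

/-- A set of boxes covers `A` exactly if the closure of `A` is the union of the boxes. -/
def CoversExactly (Z : Finset (Box ℝ)) (A : Set (ℝ × ℝ)) : Prop :=
  closure A = ⋃ b ∈ Z, b.toSet

/-- Rectilinear polygons (in general neither open nor closed). -/
structure IsRectilinearPolygon (P : Set (ℝ × ℝ)) : Prop where
  connected : IsConnected P
  union_of_boxes : ∃ Z : Finset (Box ℝ), closure P = (⋃ b ∈ Z, b.toSet) ∧
    ∀ b ∈ Z, ∀ b' ∈ Z, Disjoint b.toSet b'.toSet ∨ (b.toSet ∩ b'.toSet).Nontrivial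
  compl_components : ∀ x ∈ Pᶜ, (interior (connectedComponentIn Pᶜ x)).Nonempty

/-! ### Encodings -/

/-- A list is encoded by nested pairs, ended by the integer `0`. -/
def encodeList : List Data → Data
  | [] => .int 0
  | a :: l => .pair a (encodeList l)

/-- A rational number is encoded by its numerator and denominator in lowest terms. -/
def encodeRat (q : ℚ) : Data := .pair (.int q.num) (.int q.den)

def encodePoint (p : ℚ × ℚ) : Data := .pair (encodeRat p.1) (encodeRat p.2)

/-- A segment is encoded by its two end points. -/
def encodeSegment (e : (ℚ × ℚ) × (ℚ × ℚ)) : Data := .pair (encodePoint e.1) (encodePoint e.2)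

def encodeBox (b : Box ℚ) : Data :=
  .pair (.pair (encodeRat b.left) (encodeRat b.right))
    (.pair (encodeRat b.bottom) (encodeRat b.top))

/-- `d` is a list of the points of the finite set `S`, all of them rational, in any order. -/
def EncodesPoints (d : Data) (S : Finset (ℝ × ℝ)) : Prop :=
  ∃ l : List (ℚ × ℚ), d = encodeList (l.map encodePoint) ∧
    ∀ p : ℝ × ℝ, p ∈ S ↔ ∃ q ∈ l, ratPoint q = p

/-- `d` is a list of the boxes of the finite set `Z`, all of them rational, in any order. -/
def EncodesBoxes (d : Data) (Z : Finset (Box ℝ)) : Prop :=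
  ∃ l : List (Box ℚ), d = encodeList (l.map encodeBox) ∧
    ∀ b : Box ℝ, b ∈ Z ↔ ∃ a ∈ l, a.toReal = b

/-- `d` is a list of axis-parallel segments with rational end points that make up the boundary of
`P` (the list of the edges of `P`, for instance). -/
def EncodesPolygon (d : Data) (P : Set (ℝ × ℝ)) : Prop :=
  ∃ l : List ((ℚ × ℚ) × (ℚ × ℚ)), d = encodeList (l.map encodeSegment) ∧
    (∀ e ∈ l, e.1.1 = e.2.1 ∨ e.1.2 = e.2.2) ∧
    frontier P = ⋃ e ∈ l, segment ℝ (ratPoint e.1) (ratPoint e.2)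

/-! ### Simultaneous Boxes Class Cover -/

/-- A bichromatic finite set of points in the plane. -/
structure SBCCInstance where
  red : Finset (ℝ × ℝ)
  blue : Finset (ℝ × ℝ)
  disjoint : Disjoint red blue

/-- All points are covered, every box covers points of one color only, and no box covering a red
point meets the interior of a box covering a blue point. -/
structure IsSBCC (S : SBCCInstance) (Z : Finset (Box ℝ)) : Prop where
  covers : ∀ p, p ∈ S.red ∨ p ∈ S.blue → ∃ b ∈ Z, b.CoversPoint p
  monochromatic : ∀ b ∈ Z, (∀ p ∈ S.blue, ¬ b.CoversPoint p) ∨ (∀ p ∈ S.red, ¬ b.CoversPoint p)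
  separated : ∀ b ∈ Z, ∀ b' ∈ Z, (∃ p ∈ S.red, b.CoversPoint p) →
    (∃ p ∈ S.blue, b'.CoversPoint p) → Disjoint (interior b.toSet) (interior b'.toSet)

def SBCC : MinProblem where
  Inst := SBCCInstance
  Sol := Finset (Box ℝ)
  EncodesInst d S := ∃ dr db, d = .pair dr db ∧ EncodesPoints dr S.red ∧ EncodesPoints db S.blue
  EncodesSol := EncodesBoxes
  Feasible := IsSBCC
  cost Z := Z.card

/-! ### Simultaneous Rectilinear Polygon Cover -/

/-- A closed rectilinear polygon in the interior of a box. -/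
structure SRPCInstance where
  P : Set (ℝ × ℝ)
  K : Box ℝ
  polygon : IsRectilinearPolygon P
  closed : IsClosed P
  subset : P ⊆ interior K.toSet

open Classical in
/-- A solution is a pair `(R, B)` of sets of boxes; its cost is the cardinality of `R ∪ B`. -/
noncomputable def SRPC : MinProblem where
  Inst := SRPCInstance
  Sol := Finset (Box ℝ) × Finset (Box ℝ)
  EncodesInst d I := ∃ dP, ∃ k : Box ℚ, d = .pair dP (encodeBox k) ∧ EncodesPolygon dP I.P ∧
    k.toReal = I.K
  EncodesSol d s := ∃ dr db, d = .pair dr db ∧ EncodesBoxes dr s.1 ∧ EncodesBoxes db s.2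
  Feasible I s := CoversExactly s.1 I.P ∧ CoversExactly s.2 (I.K.toSet \ I.P)
  cost s := (s.1 ∪ s.2).card

/-! ### Polynomial-time computable functions -/

/-! The coordinates of the segment end points and of the sides of `K` cut `K` into polynomially many
cells, and each open cell lies inside or outside `P`. The reduction places one point per cell at its
pair of ranks (column, row), red if the cell is inside `P` and blue otherwise.

Exact covers give a class cover of no larger size. A box `b` is replaced by `b.rankBox`, whose
interior contains exactly the points of those cells that the interior of `b` meets; so it sees one
color only. The sides of rank boxes lie at half-integers. Hence two of them with overlapping
interiors share an integer rank in both coordinates, that is, a cell, and this is impossible for a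
red and a blue one (`isSBCC_image_rankBox`).

Conversely, the cells whose points are covered by a box of a class cover form a single box of the
grid. These rounded boxes, sorted by color, cover the polygon and its complement exactly
(`IsCellUnion.eq_iUnion`, `PolygonData.Describes.exists_output`). Neither direction increases the
cost, so the approximation factor is preserved (`MinProblem.PolyTimeApproximable.of_reduction`).

The colors are computable by parity: along a row, the color changes exactly at the grid lines that
carry a boundary edge (`mem_iff_odd_card`). This uses that `P`, as a union of boxes, is the closure
of its interior. Every stage of the algorithm is a fold along a list whose state grows by a
controlled amount per step, hence polynomial (`PolyTime.foldl`). -/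

theorem Data.one_le_size (d : Data) : 1 ≤ d.size := by
  cases d <;> (simp only [Data.size]; omega)

/-- Each rule charges for the value it returns. A time bound is therefore also a bound on the size
of intermediate results, which keeps compositions polynomial. -/
theorem Prog.Run.size_le {p : Prog} {x y : Data} {t : ℕ} (h : p.Run x y t) : y.size ≤ t := by
  induction h with
  | fork hf hg => rename_i x _ _ _ _ _ _; have := x.one_le_size; simp only [Data.size]; omega
  | _ => omega

theorem Polynomial.eval_nat_mono (q : Polynomial ℕ) {m n : ℕ} (h : m ≤ n) :
    q.eval m ≤ q.eval n := by
  induction q using Polynomial.induction_on' with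
  | add p q hp hq => simpa using add_le_add hp hq
  | monomial k a => simpa using Nat.mul_le_mul_left a (Nat.pow_le_pow_left h k)

/-- Types whose elements are presented to programs as values. -/
class DataEncoding (α : Type) where
  enc : α → Data

open DataEncoding (enc)

instance : DataEncoding ℤ := ⟨.int⟩
instance : DataEncoding ℕ := ⟨fun n => .int n⟩
instance : DataEncoding Bool := ⟨fun b => .int (if b then 1 else 0)⟩
instance : DataEncoding ℚ := ⟨encodeRat⟩
instance {α β : Type} [DataEncoding α] [DataEncoding β] : DataEncoding (α × β) :=
  ⟨fun x => .pair (enc x.1) (enc x.2)⟩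
instance {α : Type} [DataEncoding α] : DataEncoding (List α) := ⟨fun l => encodeList (l.map enc)⟩

/-- The bit size of the encoding. -/
def encSize {α : Type} [DataEncoding α] (a : α) : ℕ := (enc a).size

/-- Functions computed by programs in polynomial time. -/
def PolyTime {α β : Type} [DataEncoding α] [DataEncoding β] (f : α → β) : Prop :=
  ∃ (p : Prog) (q : Polynomial ℕ), ∀ a, ∃ t, p.Run (enc a) (enc (f a)) t ∧ t ≤ q.eval (encSize a)

section
variable {α β γ δ σ : Type} [DataEncoding α] [DataEncoding β] [DataEncoding γ] [DataEncoding δ]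
  [DataEncoding σ]

@[simp] theorem encSize_prod (a : α × β) : encSize a = 1 + encSize a.1 + encSize a.2 := rfl

@[simp] theorem encSize_nil : encSize ([] : List α) = 1 := rfl

@[simp] theorem encSize_cons (a : α) (l : List α) :
    encSize (a :: l) = 1 + encSize a + encSize l := rfl

theorem encSize_append (l l' : List α) : encSize (l ++ l') ≤ encSize l + encSize l' := by
  induction l with
  | nil => simp
  | cons a l ih => simp only [List.cons_append, encSize_cons]; omega

theorem length_le_encSize (l : List α) : l.length ≤ encSize l := by
  induction l with
  | nil => simp
  | cons a l ih => simp only [List.length_cons, encSize_cons]; omega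

theorem encSize_le_of_mem {l : List α} {a : α} (h : a ∈ l) : encSize a ≤ encSize l := by
  induction l with
  | nil => simp at h
  | cons b l ih =>
    rcases List.mem_cons.1 h with rfl | h
    · simp only [encSize_cons]; omega
    · have := ih h; simp only [encSize_cons]; omega

namespace PolyTime

theorem exists_encSize_le {f : α → β} (hf : PolyTime f) :
    ∃ q : Polynomial ℕ, ∀ a, encSize (f a) ≤ q.eval (encSize a) := by
  obtain ⟨p, q, h⟩ := hf
  exact ⟨q, fun a => let ⟨_, hr, ht⟩ := h a; hr.size_le.trans ht⟩

theorem const (b : β) : PolyTime fun _ : α => b :=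
  ⟨.const (enc b), .X + .C (encSize b), fun a => ⟨_, .const _ _, by simp [encSize]⟩⟩

/-- Elementary operations take linear time, since they add at most twice their input size. -/
theorem of_prim {f : α → β} (o : PrimOp) (h : ∀ a, o.eval (enc a) = enc (f a))
    (hs : ∀ a, encSize (f a) ≤ 2 * encSize a) : PolyTime f :=
  ⟨.prim o, 3 * .X, fun a => ⟨_, h a ▸ Prog.Run.prim o (enc a), by
    have := hs a
    simp only [Polynomial.eval_mul, Polynomial.eval_ofNat, Polynomial.eval_X, encSize] at *
    omega⟩⟩

theorem id : PolyTime fun a : α => a := of_prim .id (fun _ => rfl) (fun a => by omega)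

/-- Programs see only encodings, so one program serves all types with the same encoded values:
naturals and integers, or pairs and nonempty lists. -/
theorem of_enc_eq {f : α → β} {g : α → γ} (hf : PolyTime f) (h : ∀ a, enc (g a) = enc (f a)) :
    PolyTime g := by
  obtain ⟨p, q, hp⟩ := hf
  exact ⟨p, q, fun a => h a ▸ hp a⟩

theorem comp {g : β → γ} {f : α → β} (hg : PolyTime g) (hf : PolyTime f) :
    PolyTime fun a => g (f a) := by
  obtain ⟨p, q, hp⟩ := hf
  obtain ⟨p', q', hp'⟩ := hg
  refine ⟨.seq p p', q + q'.comp q + 1, fun a => ?_⟩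
  obtain ⟨t, hr, ht⟩ := hp a
  obtain ⟨t', hr', ht'⟩ := hp' (f a)
  refine ⟨_, .seq hr hr', ?_⟩
  have := q'.eval_nat_mono (hr.size_le.trans ht)
  simp only [Polynomial.eval_add, Polynomial.eval_comp, Polynomial.eval_one, encSize] at *
  omega

theorem pair {f : α → β} {g : α → γ} (hf : PolyTime f) (hg : PolyTime g) :
    PolyTime fun a => (f a, g a) := by
  obtain ⟨p, q, hp⟩ := hf
  obtain ⟨p', q', hp'⟩ := hg
  refine ⟨.fork p p', 2 * q + 2 * q' + .X, fun a => ?_⟩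
  obtain ⟨t, hr, ht⟩ := hp a
  obtain ⟨t', hr', ht'⟩ := hp' a
  refine ⟨_, .fork hr hr', ?_⟩
  have := hr.size_le
  have := hr'.size_le
  simp only [Polynomial.eval_add, Polynomial.eval_mul, Polynomial.eval_ofNat, Polynomial.eval_X,
    encSize] at *
  omega

theorem prod_fst : PolyTime fun a : α × β => a.1 :=
  of_prim .fst (fun _ => rfl) (fun a => by simp only [encSize_prod]; omega)

theorem prod_snd : PolyTime fun a : α × β => a.2 :=
  of_prim .snd (fun _ => rfl) (fun a => by simp only [encSize_prod]; omega)

theorem fst {f : α → β × γ} (hf : PolyTime f) : PolyTime fun a => (f a).1 := prod_fst.comp hf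

theorem snd {f : α → β × γ} (hf : PolyTime f) : PolyTime fun a => (f a).2 := prod_snd.comp hf

theorem ite {c : α → Bool} {f g : α → β} (hc : PolyTime c) (hf : PolyTime f) (hg : PolyTime g) :
    PolyTime fun a => if c a then f a else g a := by
  obtain ⟨p, q, hp⟩ := hc
  obtain ⟨p₁, q₁, hp₁⟩ := hf
  obtain ⟨p₂, q₂, hp₂⟩ := hg
  refine ⟨.ite p p₁ p₂, q + q₁ + q₂ + .X, fun a => ?_⟩
  obtain ⟨t, hr, ht⟩ := hp a
  obtain ⟨t₁, hr₁, ht₁⟩ := hp₁ a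
  obtain ⟨t₂, hr₂, ht₂⟩ := hp₂ a
  simp only [Polynomial.eval_add, Polynomial.eval_X, encSize] at *
  cases h : c a
  · rw [h] at hr
    exact ⟨_, .ite_false hr hr₂, by omega⟩
  · rw [h] at hr
    exact ⟨_, .ite_true hr (by simp [enc]) hr₁, by omega⟩

theorem not {c : α → Bool} (hc : PolyTime c) : PolyTime fun a => !c a :=
  (hc.ite (const false) (const true)).of_enc_eq fun a => by cases c a <;> rfl

theorem and {c d : α → Bool} (hc : PolyTime c) (hd : PolyTime d) : PolyTime fun a => c a && d a :=
  (hc.ite hd (const false)).of_enc_eq fun a => by cases c a <;> rfl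

theorem or {c d : α → Bool} (hc : PolyTime c) (hd : PolyTime d) : PolyTime fun a => c a || d a :=
  (hc.ite (const true) hd).of_enc_eq fun a => by cases c a <;> rfl

/-! #### Numbers -/

theorem int_mul {f g : α → ℤ} (hf : PolyTime f) (hg : PolyTime g) :
    PolyTime fun a => f a * g a := by
  refine (of_prim (f := fun x : ℤ × ℤ => x.1 * x.2) .mul (fun _ => rfl) ?_).comp (hf.pair hg)
  rintro ⟨m, n⟩
  have : Nat.size (m * n).natAbs ≤ Nat.size m.natAbs + Nat.size n.natAbs := by
    rw [Nat.size_le, Int.natAbs_mul, pow_add]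
    exact Nat.mul_lt_mul'' (Nat.lt_size_self _) (Nat.lt_size_self _)
  simp only [encSize_prod]
  simp only [encSize, enc, Data.size]
  omega

theorem int_lt {f g : α → ℤ} (hf : PolyTime f) (hg : PolyTime g) :
    PolyTime fun a => decide (f a < g a) := by
  refine (of_prim (f := fun x : ℤ × ℤ => decide (x.1 < x.2)) .lt (fun x => ?_) ?_).comp (hf.pair hg)
  · simp [enc, PrimOp.eval]
  · rintro ⟨m, n⟩
    simp only [encSize_prod]
    by_cases h : m < n <;> simp [encSize, enc, Data.size, h] <;> omega

theorem nat_succ {f : α → ℕ} (hf : PolyTime f) : PolyTime fun a => f a + 1 := by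
  have h : PolyTime fun x : ℤ × ℤ => x.1 + x.2 := by
    refine of_prim .add (fun _ => rfl) ?_
    rintro ⟨m, n⟩
    have : Nat.size (m + n).natAbs ≤ Nat.size m.natAbs + Nat.size n.natAbs + 1 := by
      rw [Nat.size_le, pow_succ, pow_add]
      have h₁ := Nat.lt_size_self m.natAbs
      have h₂ := Nat.lt_size_self n.natAbs
      have := Int.natAbs_add_le m n
      generalize (m + n).natAbs = k at *
      generalize m.natAbs.size = i at *
      generalize n.natAbs.size = j at *
      generalize m.natAbs = m at *
      generalize n.natAbs = n at *
      nlinarith [Nat.mul_le_mul (Nat.succ_le_of_lt h₁) (Nat.succ_le_of_lt h₂)]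
    simp only [encSize_prod]
    simp only [encSize, enc, Data.size]
    omega
  exact (h.comp ((hf.of_enc_eq (g := fun a => (f a : ℤ)) fun _ => rfl).pair
    (const (1 : ℤ)))).of_enc_eq fun a => by simp [enc]

/-- With denominator `1` the fraction is already in lowest terms, so no greatest common divisor has
to be computed. -/
theorem nat_cast_rat {f : α → ℕ} (hf : PolyTime f) : PolyTime fun a => (f a : ℚ) :=
  (hf.pair (const (1 : ℕ))).of_enc_eq fun a => by simp [enc, encodeRat]

theorem rat_lt {f g : α → ℚ} (hf : PolyTime f) (hg : PolyTime g) :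
    PolyTime fun a => decide (f a < g a) := by
  have hn : PolyTime Rat.num := of_prim .fst (fun _ => rfl) fun q => by
    simp only [encSize, enc, encodeRat, Data.size]; omega
  have hd : PolyTime fun q : ℚ => (q.den : ℤ) := of_prim .snd (fun _ => rfl) fun q => by
    simp only [encSize, enc, encodeRat, Data.size]; omega
  -- Comparison by cross multiplication; the denominators are positive.
  refine (int_lt (int_mul (hn.comp hf) (hd.comp hg))
    (int_mul (hn.comp hg) (hd.comp hf))).of_enc_eq fun a => ?_
  simp [Rat.lt_iff]

theorem rat_le {f g : α → ℚ} (hf : PolyTime f) (hg : PolyTime g) :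
    PolyTime fun a => decide (f a ≤ g a) :=
  (rat_lt hg hf).not.of_enc_eq fun a => by simp [← not_lt]

theorem rat_eq {f g : α → ℚ} (hf : PolyTime f) (hg : PolyTime g) :
    PolyTime fun a => decide (f a = g a) :=
  ((rat_le hf hg).and (rat_le hg hf)).of_enc_eq fun a => by simp [le_antisymm_iff]

/-! #### Lists -/

theorem cons {f : α → β} {l : α → List β} (hf : PolyTime f) (hl : PolyTime l) :
    PolyTime fun a => f a :: l a :=
  (hf.pair hl).of_enc_eq fun _ => rfl

/-- Iteration along a list, if every step increases the size of the state by an amount that is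
polynomial in the sizes of the list element and of the parameter. -/
theorem foldl {step : α × σ × δ → σ} {s : α → σ} {l : α → List δ} (hstep : PolyTime step)
    (hs : PolyTime s) (hl : PolyTime l) {Q : Polynomial ℕ}
    (hQ : ∀ a s d, encSize (step (a, s, d)) ≤ encSize s + Q.eval (encSize a + encSize d)) :
    PolyTime fun a => (l a).foldl (fun s d => step (a, s, d)) (s a) := by
  -- A nonempty list has the same encoding as the pair of its head and tail, so projections split
  -- it. The loop test is the remaining list itself: the empty list is encoded by `0`, which stops
  -- the loop.
  have hbody : PolyTime fun x : α × σ × (δ × List δ) => (x.1, step (x.1, x.2.1, x.2.2.1), x.2.2.2) :=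
    prod_fst.pair ((hstep.comp (prod_fst.pair (prod_snd.fst.pair prod_snd.snd.fst))).pair
      prod_snd.snd.snd)
  have htest : PolyTime fun x : α × σ × List δ => x.2.2 := prod_snd.snd
  obtain ⟨pb, qb, hpb⟩ := hbody
  obtain ⟨pc, qc, hpc⟩ := htest
  -- `G` bounds the growth of the state in one step, `L` the remaining list, and `B` the state
  -- during the whole remaining run. The induction keeps these bounds fixed, so all iterations share
  -- one time bound.
  have key : ∀ (a : α) (G L B : ℕ) (l : List δ) (s : σ), encSize l ≤ L →
      (∀ d ∈ l, Q.eval (encSize a + encSize d) ≤ G) → encSize s + l.length * G ≤ B →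
      ∃ t, (Prog.loop pc pb).Run (enc (a, s, l))
        (enc (a, l.foldl (fun s d => step (a, s, d)) s, ([] : List δ))) t ∧
        t ≤ (l.length + 1) * (qb.eval (encSize a + B + L + 2) + qc.eval (encSize a + B + L + 2) +
          (encSize a + B + L + 2)) := by
    intro a G L B l
    induction l with
    | nil =>
      intro s hL _ hB
      obtain ⟨t, hr, ht⟩ := hpc (a, s, [])
      have hend : (Prog.loop pc pb).Run (enc (a, s, ([] : List δ))) (enc (a, s, ([] : List δ)))
          (t + (enc (a, s, ([] : List δ))).size) := by constructor; exact hr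
      refine ⟨_, hend, ?_⟩
      have hsz : encSize (a, s, ([] : List δ)) ≤ encSize a + B + L + 2 := by
        simp only [encSize_prod] at *; omega
      have := qc.eval_nat_mono hsz
      simp only [List.length_nil, encSize] at *
      omega
    | cons d l ih =>
      intro s hL hG hB
      obtain ⟨t, hr, ht⟩ := hpc (a, s, d :: l)
      obtain ⟨t', hr', ht'⟩ := hpb (a, s, (d, l))
      have hd := (hQ a s d).trans (Nat.add_le_add_left (hG d (by simp)) _)
      rw [List.length_cons, Nat.add_one_mul] at hB
      obtain ⟨t'', hr'', ht''⟩ := ih (step (a, s, d)) (by simp only [encSize_cons] at hL; omega)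
        (fun d' h => hG d' (by simp [h])) (by omega)
      refine ⟨_, .loop_step hr (by simp [enc, encodeList]) hr' hr'', ?_⟩
      have hsz : encSize (a, s, d :: l) ≤ encSize a + B + L + 2 := by
        simp only [encSize_prod] at *; omega
      have h₁ := qc.eval_nat_mono hsz
      have h₂ := qb.eval_nat_mono hsz
      have h₃ : encSize (a, s, (d, l)) = encSize (a, s, d :: l) := rfl
      rw [h₃] at ht'
      rw [List.length_cons, Nat.add_one_mul]
      simp only [encSize] at *
      omega
  have hloop : PolyTime fun x : α × σ × List δ =>
      (x.1, x.2.2.foldl (fun s d => step (x.1, s, d)) x.2.1, ([] : List δ)) := by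
    refine ⟨.loop pc pb, (.X + 1) * (qb.comp (3 * .X + .X * Q + 2) + qc.comp (3 * .X + .X * Q + 2) +
      (3 * .X + .X * Q + 2)), ?_⟩
    rintro ⟨a, s, l⟩
    set n := encSize (a, s, l) with hn
    simp only [encSize_prod] at hn
    have hlen := length_le_encSize l
    -- At most `n` steps, each adding at most `Q.eval n` to a state of size at most `n`.
    obtain ⟨t, hr, ht⟩ := key a (Q.eval n) n (n + n * Q.eval n) l s (by omega)
      (fun d hd => Q.eval_nat_mono (by have := encSize_le_of_mem hd; omega))
      (add_le_add (by omega) (Nat.mul_le_mul_right _ (by omega)))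
    refine ⟨t, hr, ht.trans ?_⟩
    have hS : encSize a + (n + n * Q.eval n) + n + 2 ≤ 3 * n + n * Q.eval n + 2 := by omega
    simp only [Polynomial.eval_mul, Polynomial.eval_add, Polynomial.eval_comp, Polynomial.eval_X,
      Polynomial.eval_one, Polynomial.eval_ofNat]
    exact Nat.mul_le_mul (by omega)
      (add_le_add (add_le_add (qb.eval_nat_mono hS) (qc.eval_nat_mono hS)) hS)
  exact (hloop.comp (id.pair (hs.pair hl))).snd.fst

theorem reverse {l : α → List β} (hl : PolyTime l) : PolyTime fun a => (l a).reverse := by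
  have h := foldl (α := α) (step := fun x : α × List β × β => x.2.2 :: x.2.1)
    (prod_snd.snd.cons prod_snd.fst) (const ([] : List β)) hl (Q := .X + 1) fun a s d => by
      simp only [encSize_cons, Polynomial.eval_add, Polynomial.eval_X, Polynomial.eval_one]; omega
  simpa using h

theorem append {l l' : α → List β} (hl : PolyTime l) (hl' : PolyTime l') :
    PolyTime fun a => l a ++ l' a := by
  have h := foldl (α := α) (step := fun x : α × List β × β => x.2.2 :: x.2.1)
    (prod_snd.snd.cons prod_snd.fst) hl' hl.reverse (Q := .X + 1) fun a s d => by
      simp only [encSize_cons, Polynomial.eval_add, Polynomial.eval_X, Polynomial.eval_one]; omega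
  simpa using h

theorem flatMap {f : α × δ → List β} {l : α → List δ} (hf : PolyTime f) (hl : PolyTime l) :
    PolyTime fun a => (l a).flatMap fun d => f (a, d) := by
  obtain ⟨q, hq⟩ := hf.exists_encSize_le
  have h := foldl (α := α) (step := fun x : α × List β × δ => x.2.1 ++ f (x.1, x.2.2))
    (prod_snd.fst.append (hf.comp (prod_fst.pair prod_snd.snd))) (const ([] : List β)) hl
    (Q := q.comp (.X + 1)) fun a s d => by
      refine (encSize_append _ _).trans (Nat.add_le_add_left ((hq _).trans ?_) _)
      simp only [Polynomial.eval_comp, Polynomial.eval_add, Polynomial.eval_X, Polynomial.eval_one]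
      exact q.eval_nat_mono (by simp only [encSize_prod]; omega)
  simpa [List.flatMap_eq_foldl] using h

theorem map {f : α × δ → β} {l : α → List δ} (hf : PolyTime f) (hl : PolyTime l) :
    PolyTime fun a => (l a).map fun d => f (a, d) := by
  simpa [← List.map_eq_flatMap] using flatMap (hf.cons (const [])) hl

theorem filter {c : α × δ → Bool} {l : α → List δ} (hc : PolyTime c) (hl : PolyTime l) :
    PolyTime fun a => (l a).filter fun d => c (a, d) := by
  have := flatMap (hc.ite (prod_snd.cons (const [])) (const [])) hl
  refine this.of_enc_eq fun a => congrArg _ ?_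
  induction l a with
  | nil => rfl
  | cons d l ih => by_cases h : c (a, d) <;> simp [h, ih]

theorem any {c : α × δ → Bool} {l : α → List δ} (hc : PolyTime c) (hl : PolyTime l) :
    PolyTime fun a => (l a).any fun d => c (a, d) := by
  have h := foldl (α := α) (step := fun x : α × Bool × δ => x.2.1 || c (x.1, x.2.2))
    (prod_snd.fst.or (hc.comp (prod_fst.pair prod_snd.snd))) (const false) hl
    (Q := 2) fun a s d => by
      have : ∀ b : Bool, encSize b ≤ 2 := by decide
      exact (this _).trans (by simp)
  refine h.of_enc_eq fun a => congrArg _ ?_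
  have : ∀ (l : List δ) (b : Bool), (b || l.any fun d => c (a, d)) =
      l.foldl (fun s d => s || c (a, d)) b := by
    intro l
    induction l with
    | nil => simp
    | cons d l ih => intro b; simp [← ih, Bool.or_assoc]
  simpa using this (l a) false

theorem countP {c : α × δ → Bool} {l : α → List δ} (hc : PolyTime c) (hl : PolyTime l) :
    PolyTime fun a => (l a).countP fun d => c (a, d) := by
  have h := foldl (α := α) (step := fun x : α × ℕ × δ => if c (x.1, x.2.2) then x.2.1 + 1 else x.2.1)
    ((hc.comp (prod_fst.pair prod_snd.snd)).ite prod_snd.fst.nat_succ prod_snd.fst)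
    (const 0) hl (Q := 1) fun a n d => by
      -- Incrementing the counter lengthens it by at most one bit.
      have : Nat.size (n + 1) ≤ Nat.size n + 1 := by
        rw [Nat.size_le, pow_succ]
        have := Nat.lt_size_self n
        omega
      dsimp only
      split_ifs
      · simp only [encSize, enc, Data.size, Polynomial.eval_one, Int.natAbs_natCast]; omega
      · omega
  refine h.of_enc_eq fun a => congrArg _ ?_
  have : ∀ (l : List δ) (n : ℕ), (n + l.countP fun d => c (a, d)) =
      l.foldl (fun n d => if c (a, d) then n + 1 else n) n := by
    intro l
    induction l with
    | nil => simp
    | cons d l ih => intro n; by_cases h : c (a, d) <;> simp [← ih, h]; omega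
  simpa using this (l a) 0

end PolyTime
end

/-! ### Grids -/

/-- The finitely many points of `X` cut the line into gaps: `u` lies in the gap to the right of `x`. -/
def InGap (X : Finset ℚ) (x : ℚ) (u : ℝ) : Prop := x < u ∧ ∀ x' ∈ X, x < x' → u < x'

/-- The number of elements of `X` below `x`. -/
def rankIn (X : Finset ℚ) (x : ℚ) : ℕ := (X.filter (· < x)).card

/-- The points that lie on no line of the grid. -/
def offGrid (X Y : Finset ℚ) : Set (ℝ × ℝ) := {t : ℝ | ∀ x ∈ X, (x : ℝ) ≠ t} ×ˢ {t : ℝ | ∀ y ∈ Y, (y : ℝ) ≠ t}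

section gaps
variable {X : Finset ℚ} {x w : ℚ} {u : ℝ}

theorem InGap.ne (h : InGap X x u) : ∀ x' ∈ X, (x' : ℝ) ≠ u := by
  rintro x' hx' rfl
  exact lt_irrefl _ (h.2 x' hx' (Rat.cast_lt.1 h.1))

theorem InGap.le_of_le (h : InGap X x u) {x' : ℚ} (hx' : x' ∈ X) (hu : (x' : ℝ) ≤ u) : x' ≤ x :=
  not_lt.1 fun hlt => (h.2 x' hx' hlt).not_ge hu

theorem exists_inGap {l r : ℝ} (hx : x < r) (hlr : l < r) (hl : ∀ x' ∈ X, x < x' → l < x') :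
    ∃ u, InGap X x u ∧ l < u ∧ u < r := by
  -- The witness is any `u` just to the right of `max x l`.
  have h₁ : ∀ᶠ u in nhdsWithin (max (x : ℝ) l) (Ioi (max (x : ℝ) l)), max (x : ℝ) l < u :=
    eventually_mem_nhdsWithin
  have h₂ : ∀ᶠ u in nhdsWithin (max (x : ℝ) l) (Ioi (max (x : ℝ) l)),
      u < r ∧ ∀ x' ∈ X, x < x' → u < x' := by
    refine nhdsWithin_le_nhds ((eventually_lt_nhds (max_lt hx hlr)).and
      ((Finset.eventually_all X).2 fun x' hx' => ?_))
    by_cases h : x < x'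
    · exact (eventually_lt_nhds (max_lt (Rat.cast_lt.2 h) (hl x' hx' h))).mono fun _ h _ => h
    · exact Filter.Eventually.of_forall fun _ h' => absurd h' h
  obtain ⟨u, h₁, h₂, h₃⟩ := (h₁.and h₂).exists
  exact ⟨u, ⟨(le_max_left _ _).trans_lt h₁, h₃⟩, (le_max_right _ _).trans_lt h₁, h₂⟩

theorem exists_mem_inGap {a : ℚ} (ha : a ∈ X) (hau : a ≤ u) (hu : ∀ x ∈ X, (x : ℝ) ≠ u) :
    ∃ x ∈ X, InGap X x u := by
  classical
  obtain ⟨x, hx, hmax⟩ := Finset.exists_max_image (X.filter fun x : ℚ => (x : ℝ) < u) (fun x => x)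
    ⟨a, Finset.mem_filter.2 ⟨ha, lt_of_le_of_ne hau (hu a ha)⟩⟩
  rw [Finset.mem_filter] at hx
  refine ⟨x, hx.1, hx.2, fun x' hx' hlt => not_le.1 fun h => hlt.not_ge (hmax x' ?_)⟩
  exact Finset.mem_filter.2 ⟨hx', lt_of_le_of_ne h (hu x' hx')⟩

theorem isOpen_setOf_inGap : IsOpen {u | InGap X x u} := by
  have : {u | InGap X x u} = Ioi (x : ℝ) ∩ ⋂ x' ∈ X.filter (x < ·), Iio (x' : ℝ) := by
    ext u; simp [InGap]
  rw [this]
  exact isOpen_Ioi.inter (isOpen_biInter_finset fun _ _ => isOpen_Iio)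

theorem isPreconnected_setOf_inGap : IsPreconnected {u | InGap X x u} := by
  refine Set.OrdConnected.isPreconnected ⟨fun u hu u' hu' w hw => ?_⟩
  exact ⟨hu.1.trans_le hw.1, fun x' hx' h => hw.2.trans_lt (hu'.2 x' hx' h)⟩

theorem rankIn_mono : Monotone (rankIn X) := fun _ _ h =>
  Finset.card_le_card (Finset.monotone_filter_right _ fun _ _ h' => h'.trans_le h)

theorem card_filter_le_eq (hx : x ∈ X) : (X.filter (· ≤ x)).card = rankIn X x + 1 := by
  rw [rankIn, ← Finset.card_insert_of_notMem (a := x) (by simp)]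
  congr 1
  ext x'
  simp only [Finset.mem_filter, Finset.mem_insert, le_iff_eq_or_lt]
  constructor
  · rintro ⟨h, rfl | h'⟩ <;> simp_all
  · rintro (rfl | h) <;> simp_all

theorem rankIn_lt (hx : x ∈ X) (h : x < w) : rankIn X x < rankIn X w := by
  rw [← Nat.add_one_le_iff, ← card_filter_le_eq hx]
  exact Finset.card_le_card (Finset.monotone_filter_right _ fun _ _ h' => lt_of_le_of_lt h' h)

theorem rankIn_injOn : InjOn (rankIn X) X := fun _ hx _ hw h =>
  le_antisymm (not_lt.1 fun h' => (rankIn_lt hw h').ne h.symm)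
    (not_lt.1 fun h' => (rankIn_lt hx h').ne h)

end gaps

theorem dense_setOf_ne (X : Finset ℚ) : Dense {t : ℝ | ∀ x ∈ X, (x : ℝ) ≠ t} := by
  have : {t : ℝ | ∀ x ∈ X, (x : ℝ) ≠ t} = univ \ ↑(X.image ((↑) : ℚ → ℝ)) := by
    ext; simp
  rw [this]
  exact dense_univ.sdiff_finset _

theorem dense_offGrid (X Y : Finset ℚ) : Dense (offGrid X Y) :=
  (dense_setOf_ne X).prod (dense_setOf_ne Y)

/-- Away from the frontier, the space splits into the two disjoint open sets `interior P` and
`(closure P)ᶜ`, and a preconnected set stays in one of them. -/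
theorem IsPreconnected.mem_iff_of_disjoint_frontier {α : Type*} [TopologicalSpace α] {S P : Set α}
    (hS : IsPreconnected S) (h : Disjoint S (frontier P)) {p q : α} (hp : p ∈ S) (hq : q ∈ S) :
    p ∈ P ↔ q ∈ P := by
  have hsub : S ⊆ interior P ∪ (closure P)ᶜ := fun z hz => by
    by_contra hcon
    rw [mem_union, not_or, notMem_compl_iff] at hcon
    exact h.notMem_of_mem_left hz ⟨hcon.2, hcon.1⟩
  have hdis : Disjoint (interior P) (closure P)ᶜ :=
    disjoint_compl_right_iff_subset.2 (interior_subset.trans subset_closure)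
  rcases hS.subset_or_subset isOpen_interior isClosed_closure.isOpen_compl hdis hsub with h | h
  · exact iff_of_true (interior_subset (h hp)) (interior_subset (h hq))
  · exact iff_of_false (fun h' => h hp (subset_closure h')) (fun h' => h hq (subset_closure h'))

/-! ### Parity along a row of cells -/

section parity
variable {X Y : Finset ℚ} {P : Set (ℝ × ℝ)} {x y w : ℚ} {u v u' v' : ℝ}

/-- An open cell is a product of two intervals that avoids the grid lines, hence is connected and
disjoint from the frontier. -/
theorem mem_iff_mem_of_inGap
    (hF : ∀ p ∈ frontier P, (∃ x ∈ X, (x : ℝ) = p.1) ∨ ∃ y ∈ Y, (y : ℝ) = p.2)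
    (hu : InGap X x u) (hu' : InGap X x u') (hv : InGap Y y v) (hv' : InGap Y y v') :
    (u, v) ∈ P ↔ (u', v') ∈ P := by
  refine (isPreconnected_setOf_inGap.prod isPreconnected_setOf_inGap).mem_iff_of_disjoint_frontier
    (S := {u | InGap X x u} ×ˢ {v | InGap Y y v}) ?_ ⟨hu, hv⟩ ⟨hu', hv'⟩
  refine disjoint_left.2 fun p hp hp' => ?_
  rcases hF p hp' with ⟨x', hx', h⟩ | ⟨y', hy', h⟩
  · exact InGap.ne hp.1 x' hx' h
  · exact InGap.ne hp.2 y' hy' h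

/-- The boundary separates two horizontally adjacent cells if and only if exactly one of them
belongs to `P`. -/
theorem mem_frontier_iff_of_inGap
    (hF : ∀ p ∈ frontier P, (∃ x ∈ X, (x : ℝ) = p.1) ∨ ∃ y ∈ Y, (y : ℝ) = p.2)
    (hP : P ⊆ closure (interior P)) (hP' : IsClosed P) (hx : x ∈ X) (hwx : w < x)
    (hw : ∀ x' ∈ X, x' < x → x' ≤ w) (hu' : InGap X w u') (hu : InGap X x u) (hv : InGap Y y v) :
    ((x : ℝ), v) ∈ frontier P ↔ ¬ ((u', v) ∈ P ↔ (u, v) ∈ P) := by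
  constructor
  · intro hfr
    -- Near `(x, v)`, every point off the grid lies in the left or in the right cell.
    have hnear : ∀ᶠ p in nhds ((x : ℝ), v), p ∈ offGrid X Y →
        (InGap X w p.1 ∨ InGap X x p.1) ∧ InGap Y y p.2 := by
      have h₁ : ∀ᶠ t : ℝ in nhds (x : ℝ), w < t ∧ ∀ x' ∈ X, x < x' → t < x' := by
        refine (eventually_gt_nhds (Rat.cast_lt.2 hwx)).and
          ((Finset.eventually_all X).2 fun x' _ => ?_)
        by_cases h : x < x'
        · exact (eventually_lt_nhds (Rat.cast_lt.2 h)).mono fun _ h _ => h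
        · exact Filter.Eventually.of_forall fun _ h' => absurd h' h
      have h₂ : ∀ᶠ t in nhds v, InGap Y y t := isOpen_setOf_inGap.mem_nhds hv
      rw [nhds_prod_eq]
      filter_upwards [h₁.prod_mk h₂] with p ⟨⟨hp₁, hp₂⟩, hp₃⟩ hp
      refine ⟨?_, hp₃⟩
      rcases (hp.1 x hx).lt_or_gt with h | h
      · exact .inr ⟨h, hp₂⟩
      · refine .inl ⟨hp₁, fun x' hx' hlt => ?_⟩
        exact h.trans_le (Rat.cast_le.2 (not_lt.1 fun h' => (hw x' hx' h').not_gt hlt))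
    have hfreq : ∀ U : Set (ℝ × ℝ), IsOpen U → ((x : ℝ), v) ∈ closure U →
        ∃ p ∈ U, (InGap X w p.1 ∨ InGap X x p.1) ∧ InGap Y y p.2 := by
      intro U hU hcl
      have hcl' : ((x : ℝ), v) ∈ closure (U ∩ offGrid X Y) :=
        closure_minimal ((dense_offGrid X Y).open_subset_closure_inter hU) isClosed_closure hcl
      obtain ⟨p, ⟨hpU, hpG⟩, hp⟩ := ((mem_closure_iff_frequently.1 hcl').and_eventually hnear).exists
      exact ⟨p, hpU, hp hpG⟩
    rw [frontier_eq_closure_inter_closure] at hfr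
    -- Regularity of `P` makes the frontier point a limit of interior points, and it is a limit of
    -- the open complement. Both open sets therefore contain points of the two cells; these cannot
    -- be in the same cell.
    obtain ⟨p, hp, hpX, hpY⟩ := hfreq _ isOpen_interior
      (hP (hP'.closure_subset hfr.1))
    obtain ⟨q, hq, hqX, hqY⟩ := hfreq _ hP'.isOpen_compl hfr.2
    have hp := interior_subset hp
    rcases hpX with hpX | hpX <;> rcases hqX with hqX | hqX <;>
      have h₁ := mem_iff_mem_of_inGap hF hpX ‹InGap X _ _› hpY hv <;>
      have h₂ := mem_iff_mem_of_inGap hF hqX ‹InGap X _ _› hqY hv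
    · exact absurd ((mem_iff_mem_of_inGap hF hpX hqX hpY hqY).1 hp) hq
    · rw [← mem_iff_mem_of_inGap hF hpX hu' hpY hv, ← mem_iff_mem_of_inGap hF hqX hu hqY hv]
      exact fun h => hq (h.1 hp)
    · rw [← mem_iff_mem_of_inGap hF hpX hu hpY hv, ← mem_iff_mem_of_inGap hF hqX hu' hqY hv]
      exact fun h => hq (h.2 hp)
    · exact absurd ((mem_iff_mem_of_inGap hF hpX hqX hpY hqY).1 hp) hq
  · refine fun hne => not_imp_comm.1 (fun hfr => ?_) hne
    have hxu' : u' < x := hu'.2 x hx hwx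
    -- The horizontal segment from `u'` to `u` meets the grid lines only in `(x, v)`; if this is not
    -- a frontier point, the segment stays on one side of the boundary.
    refine (isPreconnected_Icc.prod isPreconnected_singleton).mem_iff_of_disjoint_frontier
      (S := Icc u' u ×ˢ {v}) ?_ (by simp [(hxu'.trans hu.1).le]) (by simp [(hxu'.trans hu.1).le])
    rw [disjoint_left]
    rintro ⟨t, s⟩ ⟨ht, rfl : s = v⟩ hp
    rcases hF _ hp with ⟨x', hx', h⟩ | ⟨y', hy', h⟩
    · dsimp only at h ht
      subst h
      have h₁ := hu.le_of_le hx' ht.2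
      have h₂ : x ≤ x' := not_lt.1 fun h' =>
        (hu'.1.trans_le ht.1).not_ge (Rat.cast_le.2 (hw x' hx' h'))
      rw [le_antisymm h₁ h₂] at hp
      exact hfr hp
    · exact hv.ne y' hy' h

/-- The parity criterion: whether a cell belongs to `P` is determined by the number of boundary
edges in its row to the left of it. -/
theorem mem_iff_odd_card
    (hF : ∀ p ∈ frontier P, (∃ x ∈ X, (x : ℝ) = p.1) ∨ ∃ y ∈ Y, (y : ℝ) = p.2)
    (hP : P ⊆ closure (interior P)) (hP' : IsClosed P) {a : ℚ} (ha : a ∈ X)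
    (haP : ∀ p ∈ P, (a : ℝ) < p.1) (hv : InGap Y y v) {cr : ℚ → Prop} [DecidablePred cr]
    (hcr : ∀ x ∈ X, cr x ↔ ((x : ℝ), v) ∈ frontier P) (hu : InGap X x u) :
    (u, v) ∈ P ↔ Odd (X.filter fun x' => x' ≤ x ∧ cr x').card := by
  -- Induction on the number of grid lines to the left. Since `x` need not belong to `X`, the base
  -- case is the region to the left of `a`, which is outside `P`.
  induction hn : (X.filter (· ≤ x)).card using Nat.strong_induction_on generalizing x u with
  | _ n ih =>
    rcases (X.filter (· ≤ x)).eq_empty_or_nonempty with hemp | hne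
    · have hax : x < a := by
        by_contra h
        exact Finset.notMem_empty a (hemp ▸ Finset.mem_filter.2 ⟨ha, not_lt.1 h⟩)
      have : (X.filter fun x' => x' ≤ x ∧ cr x') = ∅ := by
        rw [← Finset.filter_filter, hemp, Finset.filter_empty]
      rw [this]
      simpa using fun h => (hu.2 a ha hax).not_gt (haP _ h)
    · obtain ⟨m, hm, hmax⟩ := Finset.exists_max_image _ (fun x => x) hne
      obtain ⟨hmX, hmx⟩ := Finset.mem_filter.1 hm
      have hmx' : ∀ x' ∈ X, x' ≤ x ↔ x' ≤ m := fun x' hx' =>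
        ⟨fun h => hmax x' (Finset.mem_filter.2 ⟨hx', h⟩), fun h => h.trans hmx⟩
      have hum : InGap X m u := ⟨(Rat.cast_le.2 hmx).trans_lt hu.1, fun x' hx' h =>
        hu.2 x' hx' (not_le.1 fun h' => h.not_ge ((hmx' x' hx').1 h'))⟩
      -- A point slightly to the left of `m` names the preceding gap, even if `m` is the first grid
      -- line.
      obtain ⟨w, hwm, hw⟩ : ∃ w < m, ∀ x' ∈ X, x' < m → x' ≤ w := by
        have h₁ : ∀ᶠ w in nhdsWithin m (Iio m), w < m := eventually_mem_nhdsWithin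
        have h₂ : ∀ᶠ w in nhdsWithin m (Iio m), ∀ x' ∈ X, x' < m → x' ≤ w := by
          refine nhdsWithin_le_nhds ((Finset.eventually_all X).2 fun x' _ => ?_)
          by_cases h : x' < m
          · exact (eventually_gt_nhds h).mono fun _ h _ => h.le
          · exact Filter.Eventually.of_forall fun _ h' => absurd h' h
        exact (h₁.and h₂).exists
      have hwm' : ∀ x' ∈ X, x' ≤ w ↔ x' < m := fun x' hx' => ⟨fun h => h.trans_lt hwm, hw x' hx'⟩
      obtain ⟨u', hu', -, -⟩ := exists_inGap (X := X) (l := w) (Rat.cast_lt.2 hwm)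
        (Rat.cast_lt.2 hwm) fun x' _ h => Rat.cast_lt.2 h
      have hlt : (X.filter (· ≤ w)).card < n := by
        rw [← hn]
        refine Finset.card_lt_card (Finset.ssubset_iff_of_subset (Finset.monotone_filter_right _
          fun x' _ h => le_trans h (hwm.le.trans hmx)) |>.2 ⟨m, hm, ?_⟩)
        simp [hwm]
      have h₁ := ih _ hlt hu' rfl
      have h₂ := mem_frontier_iff_of_inGap hF hP hP' hmX hwm hw hu' hum hv
      rw [← hcr m hmX, h₁] at h₂
      have hA : (X.filter fun x' => x' ≤ x ∧ cr x') = X.filter fun x' => x' ≤ m ∧ cr x' :=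
        Finset.filter_congr fun x' hx' => by rw [hmx' x' hx']
      have hB : (X.filter fun x' => x' ≤ w ∧ cr x') = X.filter fun x' => x' < m ∧ cr x' :=
        Finset.filter_congr fun x' hx' => by rw [hwm' x' hx']
      rw [hB] at h₂
      rw [hA]
      by_cases hc : cr m
      · have : (X.filter fun x' => x' ≤ m ∧ cr x') =
            insert m (X.filter fun x' => x' < m ∧ cr x') := by
          ext x'
          simp only [Finset.mem_filter, Finset.mem_insert, le_iff_eq_or_lt]
          constructor
          · rintro ⟨h, h' | h', h''⟩
            exacts [.inl h', .inr ⟨h, h', h''⟩]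
          · rintro (rfl | ⟨h, h', h''⟩)
            exacts [⟨hmX, .inl rfl, hc⟩, ⟨h, .inr h', h''⟩]
        rw [this, Finset.card_insert_of_notMem (by simp), Nat.odd_add_one]
        have := h₂.1 hc
        tauto
      · have : (X.filter fun x' => x' ≤ m ∧ cr x') = X.filter fun x' => x' < m ∧ cr x' := by
          refine Finset.filter_congr fun x' _ => ?_
          rw [le_iff_eq_or_lt]
          constructor
          · rintro ⟨rfl | h', h''⟩
            exacts [absurd h'' hc, ⟨h', h''⟩]
          · exact fun h => ⟨.inr h.1, h.2⟩
        rw [this]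
        tauto

end parity

/-! ### Rounding boxes to the grid -/

theorem Box.coversPoint_iff {b : Box ℝ} {p : ℝ × ℝ} :
    b.CoversPoint p ↔ (b.left < p.1 ∧ p.1 < b.right) ∧ (b.bottom < p.2 ∧ p.2 < b.top) := by
  rw [Box.CoversPoint, Box.toSet, interior_prod_eq, interior_Icc, interior_Icc]
  rfl

theorem Box.interior_toSet (b : Box ℝ) :
    interior b.toSet = Ioo b.left b.right ×ˢ Ioo b.bottom b.top := by
  rw [Box.toSet, interior_prod_eq, interior_Icc, interior_Icc]

theorem Box.closure_interior_toSet (b : Box ℝ) : closure (interior b.toSet) = b.toSet := by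
  rw [Box.interior_toSet, closure_prod_eq, closure_Ioo b.left_lt_right.ne,
    closure_Ioo b.bottom_lt_top.ne, Box.toSet]

theorem Box.isClosed_toSet (b : Box ℝ) : IsClosed b.toSet := isClosed_Icc.prod isClosed_Icc

/-- `X` contains `a` and `c` and is contained in the interval between them. -/
structure IsGrid (X : Finset ℚ) (a c : ℚ) : Prop where
  left_mem : a ∈ X
  right_mem : c ∈ X
  mem_Icc : ∀ x ∈ X, a ≤ x ∧ x ≤ c

/-! ### Intervals of ranks -/

section rank
variable {X : Finset ℚ} {a c x : ℚ} {l r l' r' : ℝ}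

/-- The left end of the interval of ranks of the gaps that meet an interval with left end `l`. -/
noncomputable def rankLeft (X : Finset ℚ) (l : ℝ) : ℝ :=
  (X.filter fun x : ℚ => (x : ℝ) ≤ l).card - 3 / 2

/-- The right end of the interval of ranks of the gaps that meet an interval with right end `r`. -/
noncomputable def rankRight (X : Finset ℚ) (r : ℝ) : ℝ :=
  (X.filter fun x : ℚ => (x : ℝ) < r).card - 1 / 2

/-- Ranks start at `0`, so the gap just to the right of `l` has rank one less than the number of
grid points up to `l`. A further half puts the open end strictly between integers, which gives the
constant `3 / 2`. -/
theorem rankLeft_lt_rank_iff {n : ℕ} :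
    rankLeft X l < n ↔ (X.filter fun x : ℚ => (x : ℝ) ≤ l).card ≤ n + 1 := by
  rw [rankLeft]
  constructor
  · intro h
    by_contra h'
    have : ((n + 2 : ℕ) : ℝ) ≤ (X.filter fun x : ℚ => (x : ℝ) ≤ l).card := by
      exact_mod_cast not_le.1 h'
    push_cast at this
    linarith
  · intro h
    have : ((X.filter fun x : ℚ => (x : ℝ) ≤ l).card : ℝ) ≤ n + 1 := by exact_mod_cast h
    linarith

/-- The gap just to the left of `r` has rank one less than the number of grid points below `r`; here
the open end lies a half above it. -/
theorem rank_lt_rankRight_iff {n : ℕ} :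
    n < rankRight X r ↔ n + 1 ≤ (X.filter fun x : ℚ => (x : ℝ) < r).card := by
  rw [rankRight]
  constructor
  · intro h
    by_contra h'
    have : ((X.filter fun x : ℚ => (x : ℝ) < r).card : ℝ) ≤ n := by
      exact_mod_cast Nat.lt_succ_iff.1 (not_le.1 h')
    linarith
  · intro h
    have : (n + 1 : ℝ) ≤ (X.filter fun x : ℚ => (x : ℝ) < r).card := by exact_mod_cast h
    linarith

theorem rankLeft_lt_rankRight (X : Finset ℚ) (h : l < r) : rankLeft X l < rankRight X r := by
  have : ((X.filter fun x : ℚ => (x : ℝ) ≤ l).card : ℝ) ≤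
      (X.filter fun x : ℚ => (x : ℝ) < r).card := by
    exact_mod_cast Finset.card_le_card
      (Finset.monotone_filter_right _ fun _ _ h' => lt_of_le_of_lt h' h)
  rw [rankLeft, rankRight]
  linarith

theorem exists_inGap_of_rank (hx : x ∈ X) (hlr : l < r) (hl : rankLeft X l < rankIn X x)
    (hr : rankIn X x < rankRight X r) : ∃ u, InGap X x u ∧ l < u ∧ u < r := by
  rw [rankLeft_lt_rank_iff] at hl
  rw [rank_lt_rankRight_iff] at hr
  refine exists_inGap (not_le.1 fun h => ?_) hlr fun x' hx' hlt => not_le.1 fun h => ?_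
  · refine (Nat.lt_of_succ_le hr).not_ge (Finset.card_le_card (Finset.monotone_filter_right _ ?_))
    exact fun x' _ h' => Rat.cast_lt.1 (h'.trans_le h)
  · have h₁ := rankIn_lt hx hlt
    have h₂ := card_filter_le_eq hx'
    have h₃ : (X.filter (· ≤ x')).card ≤ (X.filter fun x : ℚ => (x : ℝ) ≤ l).card :=
      Finset.card_le_card (Finset.monotone_filter_right _
        fun _ _ h' => (Rat.cast_le.2 h').trans h)
    omega

/-- Weak inequalities suffice because gaps are open. This lets points of closed boxes of an exact
cover be used. -/
theorem rank_of_inGap {u : ℝ} (hx : x ∈ X) (hu : InGap X x u) (hl : l ≤ u) (hr : u ≤ r) :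
    rankLeft X l < rankIn X x ∧ rankIn X x < rankRight X r := by
  rw [rankLeft_lt_rank_iff, rank_lt_rankRight_iff, ← card_filter_le_eq hx]
  refine ⟨Finset.card_le_card fun x' h => ?_, Finset.card_le_card
    (Finset.monotone_filter_right _ fun x' _ h => ?_)⟩
  · rw [Finset.mem_filter] at h ⊢
    exact ⟨h.1, hu.le_of_le h.1 (h.2.trans hl)⟩
  · exact ((Rat.cast_le.2 h).trans_lt hu.1).trans_le hr

/-- Overlapping open intervals with half-integer ends share an integer. The first integer above the
larger left end works: it is the rank of the last grid point up to `max l l'`. The bounds by `a` and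
`c` make it the rank of an actual column of cells. -/
theorem exists_common_rank (hX : IsGrid X a c) (hlr : l < r) (hlr' : l' < r') (hl : a ≤ l)
    (hl' : a ≤ l') (hr : r ≤ c) (hr' : r' ≤ c) {s : ℝ} (h₁ : rankLeft X l < s)
    (h₂ : s < rankRight X r) (h₁' : rankLeft X l' < s) (h₂' : s < rankRight X r') :
    ∃ x ∈ X, x < c ∧ (rankLeft X l < rankIn X x ∧ rankIn X x < rankRight X r) ∧
      (rankLeft X l' < rankIn X x ∧ rankIn X x < rankRight X r') := by
  wlog h : l' ≤ l generalizing l l' r r'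
  · obtain ⟨x, hx, hc, h, h'⟩ := this hlr' hlr hl' hl hr' hr h₁' h₂' h₁ h₂ (le_of_not_ge h)
    exact ⟨x, hx, hc, h', h⟩
  obtain ⟨x, hx, hmax⟩ := Finset.exists_max_image (X.filter fun x : ℚ => (x : ℝ) ≤ l) (fun x => x)
    ⟨a, Finset.mem_filter.2 ⟨hX.left_mem, hl⟩⟩
  rw [Finset.mem_filter] at hx
  have hcard : (X.filter fun x : ℚ => (x : ℝ) ≤ l).card = rankIn X x + 1 := by
    rw [← card_filter_le_eq hx.1]
    congr 1
    refine Finset.filter_congr fun x' hx' => ⟨fun h => hmax x' (Finset.mem_filter.2 ⟨hx', h⟩),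
      fun h => (Rat.cast_le.2 h).trans hx.2⟩
  have hle : (X.filter fun x : ℚ => (x : ℝ) ≤ l').card ≤ rankIn X x + 1 :=
    hcard ▸ Finset.card_le_card (Finset.monotone_filter_right _ fun _ _ h' => h'.trans h)
  have hs : (rankIn X x : ℝ) - 1 / 2 < s := by
    have : rankLeft X l = rankIn X x - 1 / 2 := by rw [rankLeft, hcard]; push_cast; ring
    rwa [← this]
  have key : ∀ r, s < rankRight X r → (rankIn X x : ℝ) < rankRight X r := by
    intro r hsr
    rw [rank_lt_rankRight_iff]
    rw [rankRight] at hsr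
    have : ((rankIn X x : ℕ) : ℝ) < (X.filter fun x : ℚ => (x : ℝ) < r).card := by linarith
    exact_mod_cast this
  exact ⟨x, hx.1, Rat.cast_lt.1 ((hx.2.trans_lt hlr).trans_le hr),
    ⟨rankLeft_lt_rank_iff.2 hcard.le, key r h₂⟩, ⟨rankLeft_lt_rank_iff.2 hle, key r' h₂'⟩⟩

/-- The gaps with rank between `l` and `r` make up the interval from `lo` to `hi`. -/
structure IsSpan (X : Finset ℚ) (c : ℚ) (l r : ℝ) (lo hi : ℚ) : Prop where
  left_mem : lo ∈ X
  right_mem : hi ∈ X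
  lt : lo < hi
  iff : ∀ x ∈ X, x < c → ((l < rankIn X x ∧ rankIn X x < r) ↔ lo ≤ x ∧ x < hi)

end rank

/-- The box of ranks of the grid cells that meet a given box. -/
noncomputable def Box.rankBox (X Y : Finset ℚ) (b : Box ℝ) : Box ℝ where
  left := rankLeft X b.left
  right := rankRight X b.right
  bottom := rankLeft Y b.bottom
  top := rankRight Y b.top
  left_lt_right := rankLeft_lt_rankRight X b.left_lt_right
  bottom_lt_top := rankLeft_lt_rankRight Y b.bottom_lt_top

/-- The point that represents a grid cell. -/
def rankPoint (X Y : Finset ℚ) (x y : ℚ) : ℝ × ℝ := (rankIn X x, rankIn Y y)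

/-- `A` is the union of the closed cells of the grid `X × Y` that satisfy `C`. -/
structure IsCellUnion (X Y : Finset ℚ) (K : Box ℚ) (A : Set (ℝ × ℝ)) (C : ℚ → ℚ → Prop) :
    Prop where
  isClosed : IsClosed A
  subset_closure : A ⊆ closure (A ∩ offGrid X Y)
  subset : A ⊆ K.toReal.toSet
  mem_iff : ∀ x ∈ X, ∀ y ∈ Y, x < K.right → y < K.top → ∀ u v, InGap X x u → InGap Y y v →
    ((u, v) ∈ A ↔ C x y)

/-! ### Covers of cell unions and covers of points -/

section cells
variable {X Y : Finset ℚ} {K : Box ℚ} {A A' : Set (ℝ × ℝ)} {C : ℚ → ℚ → Prop} {x y : ℚ}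

/-- If the rank box covers the point of a cell, then `b` meets the open cell, and one point of it in
`A` decides the whole cell. -/
theorem IsCellUnion.of_covers_rankBox (hA : IsCellUnion X Y K A C) {b : Box ℝ} (hb : b.toSet ⊆ A)
    (hx : x ∈ X) (hy : y ∈ Y) (hxK : x < K.right) (hyK : y < K.top)
    (h : (b.rankBox X Y).CoversPoint (rankPoint X Y x y)) : C x y := by
  rw [Box.coversPoint_iff] at h
  obtain ⟨u, hu, hu₁, hu₂⟩ := exists_inGap_of_rank hx b.left_lt_right h.1.1 h.1.2
  obtain ⟨v, hv, hv₁, hv₂⟩ := exists_inGap_of_rank hy b.bottom_lt_top h.2.1 h.2.2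
  exact (hA.mem_iff x hx y hy hxK hyK u v hu hv).1
    (hb ⟨⟨hu₁.le, hu₂.le⟩, ⟨hv₁.le, hv₂.le⟩⟩)

theorem IsCellUnion.exists_covers_rankBox (hA : IsCellUnion X Y K A C) {Z : Finset (Box ℝ)}
    (hZ : A = ⋃ b ∈ Z, b.toSet)
    (hx : x ∈ X) (hy : y ∈ Y) (hxK : x < K.right) (hyK : y < K.top) (h : C x y) :
    ∃ b ∈ Z, (b.rankBox X Y).CoversPoint (rankPoint X Y x y) := by
  obtain ⟨u, hu, -⟩ := exists_inGap (X := X) (l := x) (Rat.cast_lt.2 hxK) (Rat.cast_lt.2 hxK)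
    fun x' _ h => Rat.cast_lt.2 h
  obtain ⟨v, hv, -⟩ := exists_inGap (X := Y) (l := y) (Rat.cast_lt.2 hyK) (Rat.cast_lt.2 hyK)
    fun x' _ h => Rat.cast_lt.2 h
  have hmem := (hA.mem_iff x hx y hy hxK hyK u v hu hv).2 h
  rw [hZ] at hmem
  simp only [mem_iUnion] at hmem
  obtain ⟨b, hb, h₁, h₂⟩ := hmem
  exact ⟨b, hb, Box.coversPoint_iff.2 ⟨rank_of_inGap hx hu h₁.1 h₁.2, rank_of_inGap hy hv h₂.1 h₂.2⟩⟩

theorem IsCellUnion.le_of_subset (hA : IsCellUnion X Y K A C) {b : Box ℝ} (hb : b.toSet ⊆ A) :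
    (K.left ≤ b.left ∧ b.right ≤ K.right) ∧ (K.bottom ≤ b.bottom ∧ b.top ≤ K.top) := by
  have h₁ := hA.subset (hb (show (b.left, b.bottom) ∈ b.toSet from
    ⟨⟨le_rfl, b.left_lt_right.le⟩, ⟨le_rfl, b.bottom_lt_top.le⟩⟩))
  have h₂ := hA.subset (hb (show (b.right, b.top) ∈ b.toSet from
    ⟨⟨b.left_lt_right.le, le_rfl⟩, ⟨b.bottom_lt_top.le, le_rfl⟩⟩))
  exact ⟨⟨h₁.1.1, h₂.1.2⟩, ⟨h₁.2.1, h₂.2.2⟩⟩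

open Classical in
/-- Exact covers of two complementary cell unions give a simultaneous class cover of the points
that represent the cells. -/
theorem isSBCC_image_rankBox (hX : IsGrid X K.left K.right) (hY : IsGrid Y K.bottom K.top)
    (hA : IsCellUnion X Y K A C) (hA' : IsCellUnion X Y K A' fun x y => ¬ C x y)
    {S : SBCCInstance}
    (hred : ∀ p, p ∈ S.red ↔ ∃ x ∈ X, ∃ y ∈ Y, x < K.right ∧ y < K.top ∧ C x y ∧
      rankPoint X Y x y = p)
    (hblue : ∀ p, p ∈ S.blue ↔ ∃ x ∈ X, ∃ y ∈ Y, x < K.right ∧ y < K.top ∧ ¬ C x y ∧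
      rankPoint X Y x y = p)
    {R B : Finset (Box ℝ)} (hR : A = ⋃ b ∈ R, b.toSet) (hB : A' = ⋃ b ∈ B, b.toSet) :
    IsSBCC S ((R ∪ B).image (Box.rankBox X Y)) := by
  have hR' : ∀ b ∈ R, b.toSet ⊆ A := fun b hb => hR ▸ subset_biUnion_of_mem (u := Box.toSet) hb
  have hB' : ∀ b ∈ B, b.toSet ⊆ A' := fun b hb => hB ▸ subset_biUnion_of_mem (u := Box.toSet) hb
  have hnotblue : ∀ b ∈ R, ∀ p ∈ S.blue, ¬ (b.rankBox X Y).CoversPoint p := by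
    intro b hb p hp h
    obtain ⟨x, hx, y, hy, hxK, hyK, hC, rfl⟩ := (hblue p).1 hp
    exact hC (hA.of_covers_rankBox (hR' b hb) hx hy hxK hyK h)
  have hnotred : ∀ b ∈ B, ∀ p ∈ S.red, ¬ (b.rankBox X Y).CoversPoint p := by
    intro b hb p hp h
    obtain ⟨x, hx, y, hy, hxK, hyK, hC, rfl⟩ := (hred p).1 hp
    exact hA'.of_covers_rankBox (hB' b hb) hx hy hxK hyK h hC
  refine ⟨?_, ?_, ?_⟩
  · rintro p (hp | hp)
    · obtain ⟨x, hx, y, hy, hxK, hyK, hC, rfl⟩ := (hred p).1 hp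
      obtain ⟨b, hb, h⟩ := hA.exists_covers_rankBox hR hx hy hxK hyK hC
      exact ⟨_, Finset.mem_image_of_mem _ (Finset.mem_union_left _ hb), h⟩
    · obtain ⟨x, hx, y, hy, hxK, hyK, hC, rfl⟩ := (hblue p).1 hp
      obtain ⟨b, hb, h⟩ := hA'.exists_covers_rankBox hB hx hy hxK hyK hC
      exact ⟨_, Finset.mem_image_of_mem _ (Finset.mem_union_right _ hb), h⟩
  · intro b hb
    obtain ⟨b, hbZ, rfl⟩ := Finset.mem_image.1 hb
    exact (Finset.mem_union.1 hbZ).imp (hnotblue b) (hnotred b)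
  · rintro b hb b' hb' ⟨p, hp, h⟩ ⟨p', hp', h'⟩
    obtain ⟨b, hbZ, rfl⟩ := Finset.mem_image.1 hb
    obtain ⟨b', hbZ', rfl⟩ := Finset.mem_image.1 hb'
    -- Covering a red point forces the original box into `R`, and covering a blue one forces it into
    -- `B`. A common point of the rank boxes then yields a cell that both original boxes meet.
    have hbR := (Finset.mem_union.1 hbZ).resolve_right fun hb => hnotred b hb p hp h
    have hbB := (Finset.mem_union.1 hbZ').resolve_left fun hb => hnotblue b' hb p' hp' h'
    have hl := hA.le_of_subset (hR' b hbR)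
    have hl' := hA'.le_of_subset (hB' b' hbB)
    rw [disjoint_left]
    intro q hq hq'
    have hq := Box.coversPoint_iff.1 hq
    have hq' := Box.coversPoint_iff.1 hq'
    obtain ⟨x, hx, hxK, h₁, h₁'⟩ := exists_common_rank hX b.left_lt_right b'.left_lt_right hl.1.1
      hl'.1.1 hl.1.2 hl'.1.2 hq.1.1 hq.1.2 hq'.1.1 hq'.1.2
    obtain ⟨y, hy, hyK, h₂, h₂'⟩ := exists_common_rank hY b.bottom_lt_top b'.bottom_lt_top hl.2.1
      hl'.2.1 hl.2.2 hl'.2.2 hq.2.1 hq.2.2 hq'.2.1 hq'.2.2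
    exact hA'.of_covers_rankBox (hB' b' hbB) hx hy hxK hyK (Box.coversPoint_iff.2 ⟨h₁', h₂'⟩)
      (hA.of_covers_rankBox (hR' b hbR) hx hy hxK hyK (Box.coversPoint_iff.2 ⟨h₁, h₂⟩))

/-- The box `q` is the union of the closed cells whose points are covered by `b`. -/
def IsRounding (X Y : Finset ℚ) (K : Box ℚ) (b : Box ℝ) (q : Box ℚ) : Prop :=
  IsSpan X K.right b.left b.right q.left q.right ∧ IsSpan Y K.top b.bottom b.top q.bottom q.top

theorem IsRounding.covers_iff {b : Box ℝ} {q : Box ℚ} (h : IsRounding X Y K b q) (hx : x ∈ X)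
    (hy : y ∈ Y) (hxK : x < K.right) (hyK : y < K.top) :
    b.CoversPoint (rankPoint X Y x y) ↔
      (q.left ≤ x ∧ x < q.right) ∧ (q.bottom ≤ y ∧ y < q.top) := by
  rw [Box.coversPoint_iff, ← h.1.iff x hx hxK, ← h.2.iff y hy hyK]
  rfl

theorem InGap.lt_right {c : ℚ} {u : ℝ} (h : InGap X x u) (hu : u ≤ c) : x < c :=
  Rat.cast_lt.1 (h.1.trans_le hu)

/-- The points of the open box off the grid are dense in the closed box, and `A` is closed. So it
suffices to check such points, each of which lies in a cell covered by `b`. -/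
theorem IsCellUnion.toSet_subset (hX : IsGrid X K.left K.right) (hY : IsGrid Y K.bottom K.top)
    (hA : IsCellUnion X Y K A C) {b : Box ℝ} {q : Box ℚ} (hq : IsRounding X Y K b q)
    (hb : ∀ x ∈ X, ∀ y ∈ Y, x < K.right → y < K.top → b.CoversPoint (rankPoint X Y x y) → C x y) :
    q.toReal.toSet ⊆ A := by
  rw [← Box.closure_interior_toSet]
  refine closure_minimal (((dense_offGrid X Y).open_subset_closure_inter isOpen_interior).trans
    (closure_minimal ?_ hA.isClosed)) hA.isClosed
  rintro ⟨u, v⟩ ⟨huv, hu, hv⟩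
  rw [Box.interior_toSet] at huv
  obtain ⟨⟨hu₁, hu₂⟩, ⟨hv₁, hv₂⟩⟩ := huv
  change (q.left : ℝ) < u at hu₁
  change u < (q.right : ℝ) at hu₂
  change (q.bottom : ℝ) < v at hv₁
  change v < (q.top : ℝ) at hv₂
  obtain ⟨x, hx, hxu⟩ := exists_mem_inGap hq.1.left_mem hu₁.le hu
  obtain ⟨y, hy, hyv⟩ := exists_mem_inGap hq.2.left_mem hv₁.le hv
  have hxr : x < q.right := Rat.cast_lt.1 (hxu.1.trans hu₂)
  have hyr : y < q.top := Rat.cast_lt.1 (hyv.1.trans hv₂)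
  have hxK := hxr.trans_le (hX.mem_Icc _ hq.1.right_mem).2
  have hyK := hyr.trans_le (hY.mem_Icc _ hq.2.right_mem).2
  rw [hA.mem_iff x hx y hy hxK hyK u v hxu hyv]
  exact hb x hx y hy hxK hyK ((hq.covers_iff hx hy hxK hyK).2
    ⟨⟨hxu.le_of_le hq.1.left_mem hu₁.le, hxr⟩, ⟨hyv.le_of_le hq.2.left_mem hv₁.le, hyr⟩⟩)

/-- If boxes cover the points of the cells of a cell union and no points of other cells, then the
rounded boxes cover the cell union exactly. -/
theorem IsCellUnion.eq_iUnion (hX : IsGrid X K.left K.right) (hY : IsGrid Y K.bottom K.top)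
    (hA : IsCellUnion X Y K A C) {Z R : Finset (Box ℝ)}
    (hZ : ∀ x ∈ X, ∀ y ∈ Y, x < K.right → y < K.top → C x y →
      ∃ b ∈ Z, b.CoversPoint (rankPoint X Y x y) ∧
        ∃ q : Box ℚ, q.toReal ∈ R ∧ IsRounding X Y K b q)
    (hR : ∀ r ∈ R, ∃ b : Box ℝ, ∃ q : Box ℚ, q.toReal = r ∧ IsRounding X Y K b q ∧
      ∀ x ∈ X, ∀ y ∈ Y, x < K.right → y < K.top → b.CoversPoint (rankPoint X Y x y) → C x y) :
    A = ⋃ b ∈ R, b.toSet := by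
  refine Subset.antisymm ?_ (iUnion₂_subset fun r hr => ?_)
  · refine hA.subset_closure.trans (closure_minimal ?_
      (R.finite_toSet.isClosed_biUnion fun b _ => b.isClosed_toSet))
    rintro ⟨u, v⟩ ⟨huv, hu, hv⟩
    obtain ⟨⟨hu₁, hu₂⟩, ⟨hv₁, hv₂⟩⟩ := hA.subset huv
    obtain ⟨x, hx, hxu⟩ := exists_mem_inGap hX.left_mem hu₁ hu
    obtain ⟨y, hy, hyv⟩ := exists_mem_inGap hY.left_mem hv₁ hv
    have hxK := hxu.lt_right hu₂
    have hyK := hyv.lt_right hv₂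
    obtain ⟨b, hb, hbc, q, hqR, hq⟩ :=
      hZ x hx y hy hxK hyK ((hA.mem_iff x hx y hy hxK hyK u v hxu hyv).1 huv)
    obtain ⟨⟨h₁, h₂⟩, ⟨h₃, h₄⟩⟩ := (hq.covers_iff hx hy hxK hyK).1 hbc
    refine mem_biUnion hqR ⟨⟨?_, ?_⟩, ⟨?_, ?_⟩⟩
    · exact (Rat.cast_le.2 h₁).trans hxu.1.le
    · exact (hxu.2 _ hq.1.right_mem h₂).le
    · exact (Rat.cast_le.2 h₃).trans hyv.1.le
    · exact (hyv.2 _ hq.2.right_mem h₄).le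
  · obtain ⟨b, q, rfl, hq, hb⟩ := hR r hr
    exact hA.toSet_subset hX hY hq hb

end cells

/-! ### The reduction as a polynomial-time algorithm -/

/-- The elements of `l`, without repetitions. -/
def distinct (l : List ℚ) : List ℚ :=
  l.foldl (fun acc x => if acc.any (fun y => decide (y = x)) then acc else x :: acc) []

theorem nodup_distinct_and_mem (l : List ℚ) :
    (distinct l).Nodup ∧ ∀ x, x ∈ distinct l ↔ x ∈ l := by
  have : ∀ (l acc : List ℚ), acc.Nodup →
      (l.foldl (fun acc x => if acc.any (fun y => decide (y = x)) then acc else x :: acc)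
        acc).Nodup ∧ ∀ x, x ∈ l.foldl (fun acc x => if acc.any (fun y => decide (y = x)) then acc
          else x :: acc) acc ↔ x ∈ acc ∨ x ∈ l := by
    intro l
    induction l with
    | nil => simp
    | cons a l ih =>
      intro acc hacc
      rw [List.foldl_cons]
      by_cases h : a ∈ acc
      · rw [if_pos (by simpa using h)]
        refine ⟨(ih acc hacc).1, fun x => ?_⟩
        rw [(ih acc hacc).2 x, List.mem_cons]
        constructor
        · tauto
        · rintro (h' | rfl | h') <;> tauto
      · rw [if_neg (by simpa using h)]
        have hacc' := List.nodup_cons.2 ⟨h, hacc⟩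
        refine ⟨(ih _ hacc').1, fun x => ?_⟩
        rw [(ih _ hacc').2 x, List.mem_cons, List.mem_cons]
        tauto
  simpa [distinct] using this l [] List.nodup_nil

theorem polyTime_distinct : PolyTime distinct := by
  refine PolyTime.foldl (α := List ℚ) (Q := .X + 1) (step := fun x : List ℚ × List ℚ × ℚ =>
    if x.2.1.any (fun y => decide (y = x.2.2)) then x.2.1 else x.2.2 :: x.2.1)
    (PolyTime.ite (PolyTime.any (c := fun z : (List ℚ × List ℚ × ℚ) × ℚ => decide (z.2 = z.1.2.2))
      (PolyTime.prod_snd.rat_eq PolyTime.prod_fst.snd.snd) PolyTime.prod_snd.fst)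
      PolyTime.prod_snd.fst (PolyTime.prod_snd.snd.cons PolyTime.prod_snd.fst))
    (PolyTime.const []) PolyTime.id fun a s d => ?_
  simp only [Polynomial.eval_add, Polynomial.eval_X, Polynomial.eval_one]
  split_ifs
  · omega
  · rw [encSize_cons]; omega

/-- The least element of `l` and `d`. -/
def leastWith (l : List ℚ) (d : ℚ) : ℚ := l.foldl (fun m x => if decide (x < m) then x else m) d

theorem leastWith_le_and_mem (l : List ℚ) (d : ℚ) :
    (∀ x ∈ d :: l, leastWith l d ≤ x) ∧ leastWith l d ∈ d :: l := by
  induction l generalizing d with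
  | nil => simp [leastWith]
  | cons a l ih =>
    obtain ⟨h₁, h₂⟩ := ih (if decide (a < d) then a else d)
    have : leastWith (a :: l) d = leastWith l (if decide (a < d) then a else d) := rfl
    rw [this]
    by_cases h : a < d
    · simp only [h, decide_true, if_true] at h₁ h₂ ⊢
      refine ⟨?_, List.mem_cons_of_mem _ h₂⟩
      intro x hx
      rcases List.mem_cons.1 hx with rfl | hx
      · exact (h₁ a (by simp)).trans h.le
      · exact h₁ x hx
    · simp only [h, decide_false, Bool.false_eq_true, if_false] at h₁ h₂ ⊢
      refine ⟨?_, ?_⟩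
      · intro x hx
        rcases List.mem_cons.1 hx with rfl | hx
        · exact h₁ x (by simp)
        · rcases List.mem_cons.1 hx with rfl | hx
          · exact (h₁ d (by simp)).trans (not_lt.1 h)
          · exact h₁ x (by simp [hx])
      · rcases List.mem_cons.1 h₂ with h₂ | h₂
        · rw [h₂]; simp
        · simp [h₂]

theorem PolyTime.leastWith {α : Type} [DataEncoding α] {l : α → List ℚ} {d : α → ℚ}
    (hl : PolyTime l) (hd : PolyTime d) : PolyTime fun a => leastWith (l a) (d a) := by
  refine PolyTime.foldl (Q := .X) (step := fun x : α × ℚ × ℚ =>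
    if decide (x.2.2 < x.2.1) then x.2.2 else x.2.1)
    (PolyTime.ite (prod_snd.snd.rat_lt prod_snd.fst) prod_snd.snd prod_snd.fst) hd hl
    fun a s x => ?_
  simp only [Polynomial.eval_X]
  split_ifs <;> omega

/-- A segment is given by its end points. -/
abbrev Seg := (ℚ × ℚ) × (ℚ × ℚ)

/-- The sides of a box: left, right, bottom, top. -/
abbrev Quad := (ℚ × ℚ) × (ℚ × ℚ)

def Box.toQuad (b : Box ℚ) : Quad := ((b.left, b.right), (b.bottom, b.top))

/-- A list of segments and the box `K`. -/
abbrev PolygonData := List Seg × Quad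

namespace PolygonData

/-- The sides of `K` are included so that the cells fill `K` entirely. -/
def xCoords (i : PolygonData) : List ℚ :=
  distinct (i.2.1.1 :: i.2.1.2 :: i.1.flatMap fun e => [e.1.1, e.2.1])

def yCoords (i : PolygonData) : List ℚ :=
  distinct (i.2.2.1 :: i.2.2.2 :: i.1.flatMap fun e => [e.1.2, e.2.2])

/-- Whether some vertical segment runs along the left side of the cell with corner `(x, y)`. -/
def crosses (i : PolygonData) (x y : ℚ) : Bool :=
  i.1.any fun e => (decide (e.1.1 = x) && decide (e.2.1 = x)) &&
    ((decide (e.1.2 ≤ y) && decide (y < e.2.2)) || (decide (e.2.2 ≤ y) && decide (y < e.1.2)))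

/-- Whether the cell with corner `(x, y)` is inside the polygon. -/
def inside (i : PolygonData) (x y : ℚ) : Bool :=
  i.xCoords.foldl (fun b x' => if decide (x' ≤ x) && i.crosses x' y then !b else b) false

/-- A cell is named by its lower left corner, which excludes grid points on the right and top sides
of `K`. -/
def cells (i : PolygonData) : List (ℚ × ℚ) :=
  (i.xCoords.filter fun x => decide (x < i.2.1.2)).flatMap fun x =>
    (i.yCoords.filter fun y => decide (y < i.2.2.2)).map fun y => (x, y)

/-- Ranks instead of cell centers give integer coordinates, for which the encoding in lowest terms
is immediate. -/
def point (i : PolygonData) (c : ℚ × ℚ) : ℚ × ℚ :=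
  ((i.xCoords.countP fun x => decide (x < c.1) : ℕ), (i.yCoords.countP fun y => decide (y < c.2) : ℕ))

/-- The red and the blue points. -/
def points (i : PolygonData) : List (ℚ × ℚ) × List (ℚ × ℚ) :=
  ((i.cells.filter fun c => i.inside c.1 c.2).map i.point,
    (i.cells.filter fun c => !i.inside c.1 c.2).map i.point)

/-- The box that is composed of the cells whose points are covered by `b`. -/
def round (i : PolygonData) (b : Quad) : Quad :=
  ((leastWith (i.xCoords.filter fun x => decide (b.1.1 < (i.point (x, x)).1)) i.2.1.2,
    leastWith (i.xCoords.filter fun x => decide (b.1.2 ≤ (i.point (x, x)).1)) i.2.1.2),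
   (leastWith (i.yCoords.filter fun y => decide (b.2.1 < (i.point (y, y)).2)) i.2.2.2,
    leastWith (i.yCoords.filter fun y => decide (b.2.2 ≤ (i.point (y, y)).2)) i.2.2.2))

/-- The filter discards the degenerate rectangles that arise from boxes covering no cell point. -/
def rounded (i : PolygonData) (l : List Quad) : List Quad :=
  (l.map i.round).filter fun q => decide (q.1.1 < q.1.2) && decide (q.2.1 < q.2.2)

/-- The boxes that cover the polygon, and those that cover its complement. -/
def output (i : PolygonData) (l : List Quad) : List Quad × List Quad :=
  ((i.rounded l).filter fun q => i.inside q.1.1 q.2.1,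
    (i.rounded l).filter fun q => !i.inside q.1.1 q.2.1)

open PolyTime

theorem polyTime_xCoords : PolyTime xCoords :=
  polyTime_distinct.comp (prod_snd.fst.fst.cons (prod_snd.fst.snd.cons
    (PolyTime.flatMap (f := fun a : PolygonData × Seg => [a.2.1.1, a.2.2.1])
      (prod_snd.fst.fst.cons (prod_snd.snd.fst.cons (const []))) prod_fst)))

theorem polyTime_yCoords : PolyTime yCoords :=
  polyTime_distinct.comp (prod_snd.snd.fst.cons (prod_snd.snd.snd.cons
    (PolyTime.flatMap (f := fun a : PolygonData × Seg => [a.2.1.2, a.2.2.2])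
      (prod_snd.fst.snd.cons (prod_snd.snd.snd.cons (const []))) prod_fst)))

section
variable {α : Type} [DataEncoding α] {i : α → PolygonData} {x y : α → ℚ}

theorem _root_.PolyTime.crosses (hi : PolyTime i) (hx : PolyTime x) (hy : PolyTime y) :
    PolyTime fun a => (i a).crosses (x a) (y a) := by
  have hx' : PolyTime fun z : α × Seg => x z.1 := hx.comp prod_fst
  have hy' : PolyTime fun z : α × Seg => y z.1 := hy.comp prod_fst
  exact PolyTime.any (c := fun z : α × Seg => (decide (z.2.1.1 = x z.1) && decide (z.2.2.1 = x z.1)) &&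
    ((decide (z.2.1.2 ≤ y z.1) && decide (y z.1 < z.2.2.2)) ||
      (decide (z.2.2.2 ≤ y z.1) && decide (y z.1 < z.2.1.2))))
    (((prod_snd.fst.fst.rat_eq hx').and (prod_snd.snd.fst.rat_eq hx')).and
      (((prod_snd.fst.snd.rat_le hy').and (hy'.rat_lt prod_snd.snd.snd)).or
        ((prod_snd.snd.snd.rat_le hy').and (hy'.rat_lt prod_snd.fst.snd)))) hi.fst

theorem _root_.PolyTime.inside (hi : PolyTime i) (hx : PolyTime x) (hy : PolyTime y) :
    PolyTime fun a => (i a).inside (x a) (y a) := by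
  refine PolyTime.foldl (α := α) (Q := 2) (step := fun z : α × Bool × ℚ =>
    if decide (z.2.2 ≤ x z.1) && (i z.1).crosses z.2.2 (y z.1) then !z.2.1 else z.2.1)
    (PolyTime.ite ((prod_snd.snd.rat_le (hx.comp prod_fst)).and
      (PolyTime.crosses (hi.comp prod_fst) prod_snd.snd (hy.comp prod_fst)))
      prod_snd.fst.not prod_snd.fst) (const false) (polyTime_xCoords.comp hi) fun a s d => ?_
  have : ∀ b : Bool, encSize b ≤ 2 := by decide
  exact (this _).trans (by simp)

theorem _root_.PolyTime.polygonPoint (hi : PolyTime i) (hx : PolyTime x) (hy : PolyTime y) :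
    PolyTime fun a => (i a).point (x a, y a) :=
  (PolyTime.nat_cast_rat (PolyTime.countP (c := fun z : α × ℚ => decide (z.2 < x z.1))
    (prod_snd.rat_lt (hx.comp prod_fst)) (polyTime_xCoords.comp hi))).pair
  (PolyTime.nat_cast_rat (PolyTime.countP (c := fun z : α × ℚ => decide (z.2 < y z.1))
    (prod_snd.rat_lt (hy.comp prod_fst)) (polyTime_yCoords.comp hi)))

end

theorem polyTime_cells : PolyTime cells :=
  PolyTime.flatMap (α := PolygonData) (f := fun z : PolygonData × ℚ =>
    (z.1.yCoords.filter fun y => decide (y < z.1.2.2.2)).map fun y => (z.2, y))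
    (PolyTime.map (f := fun w : (PolygonData × ℚ) × ℚ => (w.1.2, w.2)) (prod_fst.snd.pair prod_snd)
      (PolyTime.filter (c := fun w : (PolygonData × ℚ) × ℚ => decide (w.2 < w.1.1.2.2.2))
        (prod_snd.rat_lt prod_fst.fst.snd.snd.snd) (polyTime_yCoords.comp prod_fst)))
    (PolyTime.filter (c := fun z : PolygonData × ℚ => decide (z.2 < z.1.2.1.2))
      (prod_snd.rat_lt prod_fst.snd.fst.snd) polyTime_xCoords)

theorem polyTime_points : PolyTime points := by
  have h : PolyTime fun z : PolygonData × ℚ × ℚ => z.1.inside z.2.1 z.2.2 :=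
    PolyTime.inside prod_fst prod_snd.fst prod_snd.snd
  have h' : PolyTime fun z : PolygonData × ℚ × ℚ => z.1.point z.2 :=
    PolyTime.polygonPoint prod_fst prod_snd.fst prod_snd.snd
  exact (PolyTime.map h' (PolyTime.filter h polyTime_cells)).pair
    (PolyTime.map h' (PolyTime.filter h.not polyTime_cells))

theorem polyTime_round : PolyTime fun z : PolygonData × Quad => z.1.round z.2 := by
  have hx : PolyTime fun z : PolygonData × Quad => z.1.xCoords := polyTime_xCoords.comp prod_fst
  have hy : PolyTime fun z : PolygonData × Quad => z.1.yCoords := polyTime_yCoords.comp prod_fst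
  have hp : PolyTime fun w : (PolygonData × Quad) × ℚ => w.1.1.point (w.2, w.2) :=
    PolyTime.polygonPoint prod_fst.fst prod_snd prod_snd
  have hb : PolyTime fun w : (PolygonData × Quad) × ℚ => w.1.2 := prod_fst.snd
  have hk : PolyTime fun z : PolygonData × Quad => z.1.2 := prod_fst.snd
  exact ((PolyTime.leastWith (PolyTime.filter (hb.fst.fst.rat_lt hp.fst) hx) hk.fst.snd).pair
    (PolyTime.leastWith (PolyTime.filter (hb.fst.snd.rat_le hp.fst) hx) hk.fst.snd)).pair
    ((PolyTime.leastWith (PolyTime.filter (hb.snd.fst.rat_lt hp.snd) hy) hk.snd.snd).pair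
    (PolyTime.leastWith (PolyTime.filter (hb.snd.snd.rat_le hp.snd) hy) hk.snd.snd))

theorem polyTime_output : PolyTime fun z : PolygonData × List Quad => z.1.output z.2 := by
  have hr : PolyTime fun z : PolygonData × List Quad => z.1.rounded z.2 :=
    PolyTime.filter (c := fun w : (PolygonData × List Quad) × Quad =>
      decide (w.2.1.1 < w.2.1.2) && decide (w.2.2.1 < w.2.2.2))
      ((prod_snd.fst.fst.rat_lt prod_snd.fst.snd).and (prod_snd.snd.fst.rat_lt prod_snd.snd.snd))
      (PolyTime.map (polyTime_round.comp (prod_fst.fst.pair prod_snd)) prod_snd)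
  have hc : PolyTime fun w : (PolygonData × List Quad) × Quad => w.1.1.inside w.2.1.1 w.2.2.1 :=
    PolyTime.inside prod_fst.fst prod_snd.fst.fst prod_snd.snd.fst
  exact (PolyTime.filter hc hr).pair (PolyTime.filter hc.not hr)

end PolygonData

/-- An approximation preserving reduction of `B` to `A`. -/
theorem MinProblem.PolyTimeApproximable.of_reduction {A B : MinProblem} {ρ : ℝ} (hρ : 0 ≤ ρ)
    {α β γ δ : Type} [DataEncoding α] [DataEncoding β] [DataEncoding γ] [DataEncoding δ]
    {pre : α → β} {post : α × γ → δ} (hpre : PolyTime pre) (hpost : PolyTime post)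
    (h : ∀ I d, B.EncodesInst d I → ∃ i : α, d = enc i ∧ ∃ J, A.EncodesInst (enc (pre i)) J ∧
      (∀ s', B.Feasible I s' → ∃ s, A.Feasible J s ∧ A.cost s ≤ B.cost s') ∧
      ∀ out s, A.EncodesSol out s → A.Feasible J s → ∃ z : γ, out = enc z ∧
        ∃ s', B.EncodesSol (enc (post (i, z))) s' ∧ B.Feasible I s' ∧ B.cost s' ≤ A.cost s)
    (hA : A.PolyTimeApproximable ρ) : B.PolyTimeApproximable ρ := by
  obtain ⟨p, q, hp⟩ := hA
  obtain ⟨p₁, q₁, hp₁⟩ := PolyTime.id.pair hpre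
  obtain ⟨p₂, q₂, hp₂⟩ := hpost
  -- The instance is kept next to its image under `pre`, because `post` needs it to translate the
  -- solution back.
  refine ⟨.seq p₁ (.seq (.fork (.prim .fst) (.seq (.prim .snd) p)) p₂),
    q₁ + (7 * q₁ + 2 * q.comp q₁ + 1) + q₂.comp (.X + q.comp q₁ + 1) + 2, fun I d hd => ?_⟩
  obtain ⟨i, rfl, J, hJ, hle, hback⟩ := h I d hd
  obtain ⟨t₁, hr₁, ht₁⟩ := hp₁ i
  obtain ⟨out, t, s, hr, ht, hout, hs, hopt⟩ := hp J _ hJ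
  obtain ⟨z, rfl, s', hs'enc, hs', hcost⟩ := hback out s hout hs
  obtain ⟨t₂, hr₂, ht₂⟩ := hp₂ (i, z)
  have hf : (Prog.prim .fst).Run (enc (i, pre i)) (enc i) _ := .prim .fst _
  have hg : (Prog.prim .snd).Run (enc (i, pre i)) (enc (pre i)) _ := .prim .snd _
  refine ⟨_, _, s', .seq hr₁ (.seq (.fork hf (.seq hg hr)) hr₂), ?_, hs'enc, hs', fun s'' h'' => ?_⟩
  · have h₁ := hr₁.size_le.trans ht₁
    have h₂ : encSize (i, pre i) = 1 + encSize i + encSize (pre i) := rfl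
    have h₃ : encSize (i, z) = 1 + encSize i + encSize z := rfl
    have h₄ := q.eval_nat_mono (m := encSize (pre i)) (n := q₁.eval (encSize i))
      (by simp only [encSize] at *; omega)
    have h₅ : encSize z ≤ t := hr.size_le
    have h₆ := q₂.eval_nat_mono (m := encSize (i, z))
      (n := encSize i + q.eval (q₁.eval (encSize i)) + 1) (by simp only [encSize] at *; omega)
    simp only [Polynomial.eval_add, Polynomial.eval_mul, Polynomial.eval_comp, Polynomial.eval_X,
      Polynomial.eval_one, Polynomial.eval_ofNat]
    change t₁ + (((enc (i, pre i)).size + (enc i).size) + (((enc (i, pre i)).size +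
      (enc (pre i)).size) + t + 1) + (enc (i, pre i)).size + (enc i).size + (enc z).size +
      t₂ + 1) + 1 ≤ _
    simp only [encSize] at *
    omega
  · obtain ⟨s₀, hs₀, hle₀⟩ := hle s'' h''
    calc (B.cost s' : ℝ) ≤ A.cost s := by exact_mod_cast hcost
      _ ≤ ρ * A.cost s₀ := hopt s₀ hs₀
      _ ≤ ρ * B.cost s'' := mul_le_mul_of_nonneg_left (by exact_mod_cast hle₀) hρ

/-! ### Polygons as unions of cells -/

section polygon
variable {X Y : Finset ℚ} {K : Box ℚ} {P : Set (ℝ × ℝ)} {C : ℚ → ℚ → Prop}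

theorem isCellUnion_polygon
    (hP : P ⊆ closure (interior P)) (hP' : IsClosed P) (hPK : P ⊆ interior K.toReal.toSet)
    (hC : ∀ x ∈ X, ∀ y ∈ Y, x < K.right → y < K.top → ∀ u v, InGap X x u → InGap Y y v →
      ((u, v) ∈ P ↔ C x y)) : IsCellUnion X Y K P C where
  isClosed := hP'
  subset_closure := hP.trans (closure_minimal
    (((dense_offGrid X Y).open_subset_closure_inter isOpen_interior).trans
      (closure_mono (inter_subset_inter_left _ interior_subset))) isClosed_closure)
  subset := hPK.trans interior_subset
  mem_iff := hC

theorem isCellUnion_compl (hX : IsGrid X K.left K.right) (hY : IsGrid Y K.bottom K.top)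
    (hF : ∀ p ∈ frontier P, (∃ x ∈ X, (x : ℝ) = p.1) ∨ ∃ y ∈ Y, (y : ℝ) = p.2)
    (hP' : IsClosed P)
    (hC : ∀ x ∈ X, ∀ y ∈ Y, x < K.right → y < K.top → ∀ u v, InGap X x u → InGap Y y v →
      ((u, v) ∈ P ↔ C x y)) :
    IsCellUnion X Y K (closure (K.toReal.toSet \ P)) fun x y => ¬ C x y where
  isClosed := isClosed_closure
  subset_closure := by
    refine closure_minimal ?_ isClosed_closure
    have h₁ : K.toReal.toSet \ P ⊆ closure (interior K.toReal.toSet ∩ Pᶜ) := by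
      conv_lhs => rw [← Box.closure_interior_toSet]
      exact hP'.isOpen_compl.closure_inter
    refine h₁.trans (closure_minimal (((dense_offGrid X Y).open_subset_closure_inter
      (isOpen_interior.inter hP'.isOpen_compl)).trans (closure_mono (inter_subset_inter_left _ ?_)))
      isClosed_closure)
    exact (inter_subset_inter_left _ interior_subset).trans subset_closure
  subset := closure_minimal sdiff_subset (Box.isClosed_toSet _)
  mem_iff x hx y hy hxK hyK u v hu hv := by
    rw [← hC x hx y hy hxK hyK u v hu hv]
    refine ⟨fun h h' => ?_, fun h => subset_closure ⟨⟨⟨?_, ?_⟩, ⟨?_, ?_⟩⟩, h⟩⟩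
    · have hint : (u, v) ∈ interior P := by
        by_contra hint
        rcases hF (u, v) ⟨subset_closure h', hint⟩ with ⟨x', hx', h⟩ | ⟨y', hy', h⟩
        · exact hu.ne x' hx' h
        · exact hv.ne y' hy' h
      have hsub : K.toReal.toSet \ P ⊆ Pᶜ := fun p hp => hp.2
      have := closure_mono hsub h
      rw [closure_compl] at this
      exact this hint
    · exact (Rat.cast_le.2 (hX.mem_Icc x hx).1).trans hu.1.le
    · exact (hu.2 _ hX.right_mem hxK).le
    · exact (Rat.cast_le.2 (hY.mem_Icc y hy).1).trans hv.1.le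
    · exact (hv.2 _ hY.right_mem hyK).le

theorem subset_closure_interior_of_eq_iUnion {Z : Finset (Box ℝ)} (h : P = ⋃ b ∈ Z, b.toSet) :
    P ⊆ closure (interior P) := by
  conv_lhs => rw [h]
  refine iUnion₂_subset fun b hb => ?_
  rw [← Box.closure_interior_toSet]
  exact closure_mono (interior_mono (h ▸ subset_biUnion_of_mem (u := Box.toSet) hb))

end polygon

theorem mem_segment_iff_of_fst_eq {a b : ℚ × ℚ} (h : a.1 = b.1) {p : ℝ × ℝ} :
    p ∈ segment ℝ (ratPoint a) (ratPoint b) ↔ p.1 = a.1 ∧ p.2 ∈ uIcc (a.2 : ℝ) b.2 := by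
  rw [ratPoint, ratPoint, ← h, ← Prod.image_mk_segment_right, segment_eq_uIcc]
  constructor
  · rintro ⟨y, hy, rfl⟩
    exact ⟨rfl, hy⟩
  · rintro ⟨h₁, h₂⟩
    exact ⟨p.2, h₂, Prod.ext h₁.symm rfl⟩

theorem mem_segment_iff_of_snd_eq {a b : ℚ × ℚ} (h : a.2 = b.2) {p : ℝ × ℝ} :
    p ∈ segment ℝ (ratPoint a) (ratPoint b) ↔ p.2 = a.2 ∧ p.1 ∈ uIcc (a.1 : ℝ) b.1 := by
  rw [ratPoint, ratPoint, ← h, ← Prod.image_mk_segment_left, segment_eq_uIcc]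
  constructor
  · rintro ⟨y, hy, rfl⟩
    exact ⟨rfl, hy⟩
  · rintro ⟨h₁, h₂⟩
    exact ⟨p.1, h₂, Prod.ext rfl h₁.symm⟩

/-! ### Correctness of the polygon data -/

namespace PolygonData

theorem mem_xCoords {i : PolygonData} {x : ℚ} : x ∈ i.xCoords.toFinset ↔
    x = i.2.1.1 ∨ x = i.2.1.2 ∨ ∃ e ∈ i.1, x = e.1.1 ∨ x = e.2.1 := by
  rw [List.mem_toFinset, xCoords, (nodup_distinct_and_mem _).2]
  simp [List.mem_flatMap]

theorem mem_yCoords {i : PolygonData} {y : ℚ} : y ∈ i.yCoords.toFinset ↔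
    y = i.2.2.1 ∨ y = i.2.2.2 ∨ ∃ e ∈ i.1, y = e.1.2 ∨ y = e.2.2 := by
  rw [List.mem_toFinset, yCoords, (nodup_distinct_and_mem _).2]
  simp [List.mem_flatMap]

theorem nodup_xCoords (i : PolygonData) : i.xCoords.Nodup := (nodup_distinct_and_mem _).1

theorem nodup_yCoords (i : PolygonData) : i.yCoords.Nodup := (nodup_distinct_and_mem _).1

theorem countP_eq_card_filter {l : List ℚ} (hl : l.Nodup) (c : ℚ → Bool) :
    l.countP c = (l.toFinset.filter fun x => c x).card := by
  rw [List.countP_eq_length_filter, ← List.toFinset_card_of_nodup (hl.filter _),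
    List.toFinset_filter]

theorem point_eq (i : PolygonData) (x y : ℚ) : i.point (x, y) =
    ((rankIn i.xCoords.toFinset x : ℚ), (rankIn i.yCoords.toFinset y : ℚ)) := by
  rw [point, countP_eq_card_filter i.nodup_xCoords, countP_eq_card_filter i.nodup_yCoords]
  simp [rankIn]

theorem ratPoint_point (i : PolygonData) (x y : ℚ) : ratPoint (i.point (x, y)) =
    rankPoint i.xCoords.toFinset i.yCoords.toFinset x y := by
  rw [point_eq]
  simp [ratPoint, rankPoint]

theorem mem_cells {i : PolygonData} {c : ℚ × ℚ} : c ∈ i.cells ↔ c.1 ∈ i.xCoords.toFinset ∧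
    c.2 ∈ i.yCoords.toFinset ∧ c.1 < i.2.1.2 ∧ c.2 < i.2.2.2 := by
  simp only [cells, List.mem_flatMap, List.mem_filter, List.mem_map, decide_eq_true_eq,
    List.mem_toFinset]
  constructor
  · rintro ⟨x, ⟨hx, hx'⟩, y, ⟨hy, hy'⟩, rfl⟩
    exact ⟨hx, hy, hx', hy'⟩
  · rintro ⟨hx, hy, hx', hy'⟩
    exact ⟨c.1, ⟨hx, hx'⟩, c.2, ⟨hy, hy'⟩, rfl⟩

theorem inside_iff (i : PolygonData) (x y : ℚ) : i.inside x y ↔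
    Odd (i.xCoords.toFinset.filter fun x' => x' ≤ x ∧ i.crosses x' y).card := by
  have : ∀ (l : List ℚ) (b : Bool),
      l.foldl (fun b x' => if decide (x' ≤ x) && i.crosses x' y then !b else b) b =
        xor b (decide (Odd (l.countP fun x' => decide (x' ≤ x) && i.crosses x' y))) := by
    intro l
    induction l with
    | nil => simp
    | cons a l ih =>
      intro b
      rw [List.foldl_cons, ih, List.countP_cons]
      by_cases h : (decide (a ≤ x) && i.crosses a y) = true
      · simp only [h, if_true, Nat.odd_add_one, decide_not]
        cases b <;> simp
      · simp only [h, if_false, Bool.false_eq_true, Nat.add_zero]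
  rw [inside, this, countP_eq_card_filter i.nodup_xCoords]
  simp

/-- The data `i` describe the polygon `P` in the box `K`. -/
structure Describes (i : PolygonData) (P : Set (ℝ × ℝ)) (K : Box ℚ) : Prop where
  box : i.2 = K.toQuad
  parallel : ∀ e ∈ i.1, e.1.1 = e.2.1 ∨ e.1.2 = e.2.2
  frontier : frontier P = ⋃ e ∈ i.1, segment ℝ (ratPoint e.1) (ratPoint e.2)
  isClosed : IsClosed P
  subset : P ⊆ interior K.toReal.toSet
  regular : P ⊆ closure (interior P)

section describes
variable {i : PolygonData} {P : Set (ℝ × ℝ)} {K : Box ℚ}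

theorem Describes.isGrid (h : i.Describes P K) :
    IsGrid i.xCoords.toFinset K.left K.right ∧ IsGrid i.yCoords.toFinset K.bottom K.top := by
  have hmem : ∀ e ∈ i.1, ∀ p ∈ segment ℝ (ratPoint e.1) (ratPoint e.2), p ∈ K.toReal.toSet := by
    intro e he p hp
    -- The segments lie in the frontier of the closed set `P`, hence in `K`, so no grid line falls
    -- outside `K`.
    refine interior_subset (h.subset (h.isClosed.frontier_subset ?_))
    rw [h.frontier]
    exact mem_biUnion he hp
  have h₁ : ∀ e ∈ i.1, ((K.left ≤ e.1.1 ∧ e.1.1 ≤ K.right) ∧ (K.bottom ≤ e.1.2 ∧ e.1.2 ≤ K.top)) ∧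
      ((K.left ≤ e.2.1 ∧ e.2.1 ≤ K.right) ∧ (K.bottom ≤ e.2.2 ∧ e.2.2 ≤ K.top)) := by
    intro e he
    obtain ⟨⟨h₁, h₂⟩, ⟨h₃, h₄⟩⟩ := hmem e he _ (left_mem_segment ℝ _ _)
    obtain ⟨⟨h₅, h₆⟩, ⟨h₇, h₈⟩⟩ := hmem e he _ (right_mem_segment ℝ _ _)
    exact ⟨⟨⟨Rat.cast_le.1 h₁, Rat.cast_le.1 h₂⟩, ⟨Rat.cast_le.1 h₃, Rat.cast_le.1 h₄⟩⟩,
      ⟨⟨Rat.cast_le.1 h₅, Rat.cast_le.1 h₆⟩, ⟨Rat.cast_le.1 h₇, Rat.cast_le.1 h₈⟩⟩⟩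
  have hl := K.left_lt_right.le
  have hb := K.bottom_lt_top.le
  constructor
  · refine ⟨mem_xCoords.2 (by simp [h.box, Box.toQuad]), mem_xCoords.2 (by simp [h.box, Box.toQuad]),
      fun x hx => ?_⟩
    rcases mem_xCoords.1 hx with rfl | rfl | ⟨e, he, rfl | rfl⟩
    · rw [h.box]; exact ⟨le_rfl, hl⟩
    · rw [h.box]; exact ⟨hl, le_rfl⟩
    · exact (h₁ e he).1.1
    · exact (h₁ e he).2.1
  · refine ⟨mem_yCoords.2 (by simp [h.box, Box.toQuad]), mem_yCoords.2 (by simp [h.box, Box.toQuad]),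
      fun x hx => ?_⟩
    rcases mem_yCoords.1 hx with rfl | rfl | ⟨e, he, rfl | rfl⟩
    · rw [h.box]; exact ⟨le_rfl, hb⟩
    · rw [h.box]; exact ⟨hb, le_rfl⟩
    · exact (h₁ e he).1.2
    · exact (h₁ e he).2.2

theorem Describes.frontier_subset_grid (h : i.Describes P K) : ∀ p ∈ _root_.frontier P,
    (∃ x ∈ i.xCoords.toFinset, (x : ℝ) = p.1) ∨ ∃ y ∈ i.yCoords.toFinset, (y : ℝ) = p.2 := by
  intro p hp
  rw [h.frontier] at hp
  simp only [mem_iUnion] at hp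
  obtain ⟨e, he, hp⟩ := hp
  rcases h.parallel e he with h' | h'
  · exact .inl ⟨_, mem_xCoords.2 (.inr (.inr ⟨e, he, .inl rfl⟩)),
      ((mem_segment_iff_of_fst_eq h').1 hp).1.symm⟩
  · exact .inr ⟨_, mem_yCoords.2 (.inr (.inr ⟨e, he, .inl rfl⟩)),
      ((mem_segment_iff_of_snd_eq h').1 hp).1.symm⟩

/-- The end points of all segments have grid coordinates while `v` lies strictly inside a gap. Thus
a vertical segment contains height `v` if and only if it spans the whole gap, and no horizontal
segment has height `v`. -/
theorem Describes.crosses_iff (h : i.Describes P K) {x y : ℚ} {v : ℝ}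
    (hv : InGap i.yCoords.toFinset y v) : i.crosses x y ↔ ((x : ℝ), v) ∈ _root_.frontier P := by
  have hm₁ : ∀ e ∈ i.1, e.1.2 ∈ i.yCoords.toFinset := fun e he =>
    mem_yCoords.2 (.inr (.inr ⟨e, he, .inl rfl⟩))
  have hm₂ : ∀ e ∈ i.1, e.2.2 ∈ i.yCoords.toFinset := fun e he =>
    mem_yCoords.2 (.inr (.inr ⟨e, he, .inr rfl⟩))
  rw [h.frontier]
  simp only [crosses, List.any_eq_true, Bool.and_eq_true, Bool.or_eq_true, decide_eq_true_eq,
    mem_iUnion]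
  constructor
  · rintro ⟨e, he, ⟨rfl, h₂⟩, h₃⟩
    refine ⟨e, he, (mem_segment_iff_of_fst_eq h₂.symm).2 ⟨rfl, mem_uIcc.2 ?_⟩⟩
    rcases h₃ with ⟨h₃, h₄⟩ | ⟨h₃, h₄⟩
    · exact .inl ⟨(Rat.cast_le.2 h₃).trans hv.1.le, (hv.2 _ (hm₂ e he) h₄).le⟩
    · exact .inr ⟨(Rat.cast_le.2 h₃).trans hv.1.le, (hv.2 _ (hm₁ e he) h₄).le⟩
  · rintro ⟨e, he, hp⟩
    rcases h.parallel e he with h' | h'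
    · obtain ⟨h₁, h₂⟩ := (mem_segment_iff_of_fst_eq h').1 hp
      have hx : x = e.1.1 := Rat.cast_injective h₁
      refine ⟨e, he, ⟨hx.symm, by rw [hx, h']⟩, ?_⟩
      rcases mem_uIcc.1 h₂ with ⟨h₃, h₄⟩ | ⟨h₃, h₄⟩
      · exact .inl ⟨hv.le_of_le (hm₁ e he) h₃, Rat.cast_lt.1 (hv.1.trans_le h₄)⟩
      · exact .inr ⟨hv.le_of_le (hm₂ e he) h₃, Rat.cast_lt.1 (hv.1.trans_le h₄)⟩
    · exact absurd ((mem_segment_iff_of_snd_eq h').1 hp).1.symm (hv.ne _ (hm₁ e he))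

theorem Describes.mem_iff_inside (h : i.Describes P K) {x y : ℚ} {u v : ℝ}
    (hu : InGap i.xCoords.toFinset x u) (hv : InGap i.yCoords.toFinset y v) :
    (u, v) ∈ P ↔ i.inside x y := by
  rw [inside_iff]
  refine mem_iff_odd_card h.frontier_subset_grid h.regular h.isClosed h.isGrid.1.left_mem
    (fun p hp => ?_) hv (fun x _ => h.crosses_iff hv) hu
  exact (Box.coversPoint_iff.1 (h.subset hp)).1.1

theorem Describes.isCellUnion (h : i.Describes P K) :
    IsCellUnion i.xCoords.toFinset i.yCoords.toFinset K P fun x y => i.inside x y :=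
  isCellUnion_polygon h.regular h.isClosed h.subset
    fun _ _ _ _ _ _ _ _ hu hv => h.mem_iff_inside hu hv

theorem Describes.isCellUnion_compl (h : i.Describes P K) :
    IsCellUnion i.xCoords.toFinset i.yCoords.toFinset K (closure (K.toReal.toSet \ P))
      fun x y => ¬ i.inside x y :=
  _root_.isCellUnion_compl h.isGrid.1 h.isGrid.2 h.frontier_subset_grid h.isClosed
    fun _ _ _ _ _ _ _ _ hu hv => h.mem_iff_inside hu hv

end describes

/-- The span of an interval of ranks, by minimization. -/
theorem leastWith_spec {l : List ℚ} {a c : ℚ} (hl : IsGrid l.toFinset a c) (r : ℚ) :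
    (leastWith (l.filter fun x => decide (r < rankIn l.toFinset x)) c ∈ l.toFinset ∧
      ∀ x ∈ l.toFinset, x < c → ((r : ℝ) < rankIn l.toFinset x ↔
        leastWith (l.filter fun x => decide (r < rankIn l.toFinset x)) c ≤ x)) ∧
    (leastWith (l.filter fun x => decide (r ≤ rankIn l.toFinset x)) c ∈ l.toFinset ∧
      ∀ x ∈ l.toFinset, x < c → (rankIn l.toFinset x < (r : ℝ) ↔
        x < leastWith (l.filter fun x => decide (r ≤ rankIn l.toFinset x)) c)) := by
  -- An upward closed condition on grid points is described by its least element. The default `c` is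
  -- correct when no grid point satisfies it, since only `x < c` is tested.
  have key : ∀ f : ℚ → Bool, (∀ x x', x ≤ x' → f x → f x') →
      leastWith (l.filter f) c ∈ l.toFinset ∧
      ∀ x ∈ l.toFinset, x < c → (f x ↔ leastWith (l.filter f) c ≤ x) := by
    intro f hf
    obtain ⟨h₁, h₂⟩ := leastWith_le_and_mem (l.filter f) c
    refine ⟨?_, fun x hx hxc => ⟨fun h => h₁ x ?_, fun h => ?_⟩⟩
    · rcases List.mem_cons.1 h₂ with h₂ | h₂
      · rw [h₂]; exact hl.right_mem
      · exact List.mem_toFinset.2 (List.mem_filter.1 h₂).1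
    · exact List.mem_cons_of_mem _ (List.mem_filter.2 ⟨List.mem_toFinset.1 hx, h⟩)
    · rcases List.mem_cons.1 h₂ with h₂ | h₂
      · rw [h₂] at h; exact absurd h hxc.not_ge
      · exact hf _ _ h (List.mem_filter.1 h₂).2
  have hcast : ∀ x, (r : ℝ) < rankIn l.toFinset x ↔ r < rankIn l.toFinset x := fun x => by
    exact_mod_cast Iff.rfl
  have hcast' : ∀ x, rankIn l.toFinset x < (r : ℝ) ↔ rankIn l.toFinset x < r := fun x => by
    exact_mod_cast Iff.rfl
  constructor
  · obtain ⟨h₁, h₂⟩ := key (fun x => decide (r < rankIn l.toFinset x)) fun x x' h => by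
      simpa using fun h' : r < _ => h'.trans_le (by exact_mod_cast rankIn_mono h)
    exact ⟨h₁, fun x hx hxc => by rw [hcast, ← h₂ x hx hxc, decide_eq_true_eq]⟩
  · obtain ⟨h₁, h₂⟩ := key (fun x => decide (r ≤ rankIn l.toFinset x)) fun x x' h => by
      simpa using fun h' : r ≤ _ => h'.trans (by exact_mod_cast rankIn_mono h)
    exact ⟨h₁, fun x hx hxc => by rw [hcast', ← not_le, ← not_le, not_iff_not, ← h₂ x hx hxc,
      decide_eq_true_eq]⟩

section rounding
variable {i : PolygonData} {K : Box ℚ}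

/-- The second part ensures that the rounding of a box covering some cell point is nondegenerate and
survives the filter in `rounded`. -/
theorem round_spec (hK : i.2 = K.toQuad) (hX : IsGrid i.xCoords.toFinset K.left K.right)
    (hY : IsGrid i.yCoords.toFinset K.bottom K.top) (b : Box ℚ) :
    (∀ q : Box ℚ, q.toQuad = i.round b.toQuad →
      IsRounding i.xCoords.toFinset i.yCoords.toFinset K b.toReal q) ∧
    ∀ x ∈ i.xCoords.toFinset, ∀ y ∈ i.yCoords.toFinset, x < K.right → y < K.top →
      b.toReal.CoversPoint (rankPoint i.xCoords.toFinset i.yCoords.toFinset x y) →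
      (i.round b.toQuad).1.1 < (i.round b.toQuad).1.2 ∧
        (i.round b.toQuad).2.1 < (i.round b.toQuad).2.2 := by
  obtain ⟨h₁, h₁'⟩ := (leastWith_spec hX b.left).1
  obtain ⟨h₂, h₂'⟩ := (leastWith_spec hX b.right).2
  obtain ⟨h₃, h₃'⟩ := (leastWith_spec hY b.bottom).1
  obtain ⟨h₄, h₄'⟩ := (leastWith_spec hY b.top).2
  have hround : i.round b.toQuad = ((leastWith (i.xCoords.filter fun x =>
        decide (b.left < rankIn i.xCoords.toFinset x)) K.right,
      leastWith (i.xCoords.filter fun x =>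
        decide (b.right ≤ rankIn i.xCoords.toFinset x)) K.right),
      (leastWith (i.yCoords.filter fun y =>
        decide (b.bottom < rankIn i.yCoords.toFinset y)) K.top,
      leastWith (i.yCoords.filter fun y =>
        decide (b.top ≤ rankIn i.yCoords.toFinset y)) K.top)) := by
    simp only [round, point_eq, hK, Box.toQuad]
  rw [hround]
  refine ⟨fun q hq => ?_, fun x hx y hy hxK hyK hc => ?_⟩
  · simp only [Box.toQuad, Prod.mk.injEq] at hq
    obtain ⟨⟨hq₁, hq₂⟩, ⟨hq₃, hq₄⟩⟩ := hq
    rw [← hq₁] at h₁ h₁'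
    rw [← hq₂] at h₂ h₂'
    rw [← hq₃] at h₃ h₃'
    rw [← hq₄] at h₄ h₄'
    exact ⟨⟨h₁, h₂, q.left_lt_right, fun x hx hxK => and_congr (h₁' x hx hxK) (h₂' x hx hxK)⟩,
      ⟨h₃, h₄, q.bottom_lt_top, fun y hy hyK => and_congr (h₃' y hy hyK) (h₄' y hy hyK)⟩⟩
  · rw [Box.coversPoint_iff] at hc
    exact ⟨((h₁' x hx hxK).1 hc.1.1).trans_lt ((h₂' x hx hxK).1 hc.1.2),
      ((h₃' y hy hyK).1 hc.2.1).trans_lt ((h₄' y hy hyK).1 hc.2.2)⟩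

end rounding

theorem mem_rounded {i : PolygonData} {l : List Quad} {q : Quad} :
    q ∈ i.rounded l ↔ (∃ b ∈ l, i.round b = q) ∧ q.1.1 < q.1.2 ∧ q.2.1 < q.2.2 := by
  simp [rounded]

end PolygonData

theorem exists_map_toQuad_eq (l : List Quad) (h : ∀ q ∈ l, q.1.1 < q.1.2 ∧ q.2.1 < q.2.2) :
    ∃ l' : List (Box ℚ), l'.map Box.toQuad = l := by
  induction l with
  | nil => exact ⟨[], rfl⟩
  | cons q l ih =>
    obtain ⟨l', rfl⟩ := ih fun q hq => h q (by simp [hq])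
    exact ⟨⟨q.1.1, q.1.2, q.2.1, q.2.2, (h q (by simp)).1, (h q (by simp)).2⟩ :: l', rfl⟩

theorem Box.toReal_injective : Function.Injective Box.toReal := by
  rintro ⟨a, b, c, d, _, _⟩ ⟨a', b', c', d', _, _⟩ h
  simpa [Box.toReal] using h

theorem Box.toQuad_injective : Function.Injective Box.toQuad := by
  rintro ⟨a, b, c, d, _, _⟩ ⟨a', b', c', d', _, _⟩ h
  simpa [Box.toQuad, and_assoc] using h

theorem enc_map_toQuad (l : List (Box ℚ)) : enc (l.map Box.toQuad) = encodeList (l.map encodeBox) := by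
  change encodeList ((l.map Box.toQuad).map enc) = _
  rw [List.map_map]
  rfl

/-! ### From a class cover back to exact covers -/

namespace PolygonData
variable {i : PolygonData} {P A : Set (ℝ × ℝ)} {K : Box ℚ} {l : List (Box ℚ)}

theorem exists_encodesBoxes_of_isCellUnion {c : ℚ → ℚ → Bool} (hK : i.2 = K.toQuad)
    (hX : IsGrid i.xCoords.toFinset K.left K.right)
    (hY : IsGrid i.yCoords.toFinset K.bottom K.top)
    (hA : IsCellUnion i.xCoords.toFinset i.yCoords.toFinset K A fun x y => c x y)
    (hcov : ∀ x ∈ i.xCoords.toFinset, ∀ y ∈ i.yCoords.toFinset, x < K.right → y < K.top → c x y →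
      ∃ b ∈ l, b.toReal.CoversPoint (rankPoint i.xCoords.toFinset i.yCoords.toFinset x y))
    (hmono : ∀ b ∈ l, ∀ x ∈ i.xCoords.toFinset, ∀ y ∈ i.yCoords.toFinset, x < K.right → y < K.top →
      b.toReal.CoversPoint (rankPoint i.xCoords.toFinset i.yCoords.toFinset x y) → c x y →
      ∀ x' ∈ i.xCoords.toFinset, ∀ y' ∈ i.yCoords.toFinset, x' < K.right → y' < K.top →
      b.toReal.CoversPoint (rankPoint i.xCoords.toFinset i.yCoords.toFinset x' y') → c x' y') :
    ∃ R : Finset (Box ℝ),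
      EncodesBoxes (enc ((i.rounded (l.map Box.toQuad)).filter fun q => c q.1.1 q.2.1)) R ∧
      A = (⋃ b ∈ R, b.toSet) ∧
      ∀ r ∈ R, ∃ b ∈ l, ∃ q : Box ℚ, q.toReal = r ∧ q.toQuad = i.round b.toQuad := by
  classical
  obtain ⟨lR, hlR⟩ := exists_map_toQuad_eq
    ((i.rounded (l.map Box.toQuad)).filter fun q => c q.1.1 q.2.1)
    fun q hq => (mem_rounded.1 (List.mem_filter.1 hq).1).2
  have hmem : ∀ q : Box ℚ, q ∈ lR ↔ (∃ b ∈ l, q.toQuad = i.round b.toQuad) ∧ c q.left q.bottom := by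
    intro q
    rw [← List.mem_map_of_injective Box.toQuad_injective, hlR, List.mem_filter, mem_rounded]
    simp only [List.mem_map, exists_exists_and_eq_and]
    constructor
    · rintro ⟨⟨⟨b, hb, h⟩, -⟩, hc⟩
      exact ⟨⟨b, hb, h.symm⟩, hc⟩
    · rintro ⟨⟨b, hb, h⟩, hc⟩
      exact ⟨⟨⟨b, hb, h.symm⟩, q.left_lt_right, q.bottom_lt_top⟩, hc⟩
  -- The lower left cell of a rounded box is itself covered by `b`. As `b` is monochromatic, the
  -- color of that one cell is the color of the whole rounded box.
  have hcorner : ∀ (b q : Box ℚ), q.toQuad = i.round b.toQuad →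
      (q.left ∈ i.xCoords.toFinset ∧ q.bottom ∈ i.yCoords.toFinset ∧ q.left < K.right ∧
        q.bottom < K.top) ∧ b.toReal.CoversPoint
          (rankPoint i.xCoords.toFinset i.yCoords.toFinset q.left q.bottom) := by
    intro b q h
    have hq := (round_spec hK hX hY b).1 q h
    have h₁ := q.left_lt_right.trans_le (hX.mem_Icc _ hq.1.right_mem).2
    have h₂ := q.bottom_lt_top.trans_le (hY.mem_Icc _ hq.2.right_mem).2
    exact ⟨⟨hq.1.left_mem, hq.2.left_mem, h₁, h₂⟩,
      (hq.covers_iff hq.1.left_mem hq.2.left_mem h₁ h₂).2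
        ⟨⟨le_rfl, q.left_lt_right⟩, ⟨le_rfl, q.bottom_lt_top⟩⟩⟩
  refine ⟨(lR.map Box.toReal).toFinset, ⟨lR, ?_, by simp⟩, ?_, ?_⟩
  · rw [← hlR, enc_map_toQuad]
  · refine hA.eq_iUnion hX hY (Z := (l.map Box.toReal).toFinset) ?_ ?_
    · intro x hx y hy hxK hyK hc
      obtain ⟨b, hb, hbc⟩ := hcov x hx y hy hxK hyK hc
      obtain ⟨h₁, h₂⟩ := (round_spec hK hX hY b).2 x hx y hy hxK hyK hbc
      let q : Box ℚ := ⟨(i.round b.toQuad).1.1, (i.round b.toQuad).1.2, (i.round b.toQuad).2.1,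
        (i.round b.toQuad).2.2, h₁, h₂⟩
      obtain ⟨⟨hm₁, hm₂, hm₃, hm₄⟩, hm⟩ := hcorner b q rfl
      refine ⟨b.toReal, by simpa using ⟨b, hb, rfl⟩, hbc, q, ?_, (round_spec hK hX hY b).1 q rfl⟩
      rw [List.mem_toFinset]
      exact List.mem_map_of_mem ((hmem q).2 ⟨⟨b, hb, rfl⟩,
        hmono b hb x hx y hy hxK hyK hbc hc _ hm₁ _ hm₂ hm₃ hm₄ hm⟩)
    · intro r hr
      obtain ⟨q, hq, rfl⟩ := List.mem_map.1 (List.mem_toFinset.1 hr)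
      obtain ⟨⟨b, hb, hbq⟩, hc⟩ := (hmem q).1 hq
      obtain ⟨⟨hm₁, hm₂, hm₃, hm₄⟩, hm⟩ := hcorner b q hbq
      exact ⟨b.toReal, q, rfl, (round_spec hK hX hY b).1 q hbq, fun x hx y hy hxK hyK hbc =>
        hmono b hb _ hm₁ _ hm₂ hm₃ hm₄ hm hc x hx y hy hxK hyK hbc⟩
  · intro r hr
    obtain ⟨q, hq, rfl⟩ := List.mem_map.1 (List.mem_toFinset.1 hr)
    obtain ⟨⟨b, hb, hbq⟩, -⟩ := (hmem q).1 hq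
    exact ⟨b, hb, q, rfl, hbq⟩

/-- The bichromatic point set that represents the cells inside and outside the polygon. -/
noncomputable def sbccInstance (i : PolygonData) : SBCCInstance where
  red := i.points.1.toFinset.image ratPoint
  blue := i.points.2.toFinset.image ratPoint
  disjoint := by
    rw [Finset.disjoint_left]
    simp only [points, Finset.mem_image, List.mem_toFinset, List.mem_map, List.mem_filter,
      mem_cells, exists_exists_and_eq_and]
    rintro _ ⟨⟨x, y⟩, ⟨⟨hx, hy, -⟩, hc⟩, rfl⟩ ⟨⟨x', y'⟩, ⟨⟨hx', hy', -⟩, hc'⟩, h⟩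
    -- A rank pair determines its cell, so no point receives both colors.
    rw [ratPoint_point, ratPoint_point, rankPoint, rankPoint, Prod.mk.injEq, Nat.cast_inj,
      Nat.cast_inj] at h
    obtain rfl := rankIn_injOn (List.mem_toFinset.2 hx') (List.mem_toFinset.2 hx) h.1
    obtain rfl := rankIn_injOn (List.mem_toFinset.2 hy') (List.mem_toFinset.2 hy) h.2
    simp_all

theorem mem_red_iff (hK : i.2 = K.toQuad) (p : ℝ × ℝ) : p ∈ i.sbccInstance.red ↔
    ∃ x ∈ i.xCoords.toFinset, ∃ y ∈ i.yCoords.toFinset, x < K.right ∧ y < K.top ∧ i.inside x y ∧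
      rankPoint i.xCoords.toFinset i.yCoords.toFinset x y = p := by
  simp only [sbccInstance, points, Finset.mem_image, List.mem_toFinset, List.mem_map,
    List.mem_filter, mem_cells, exists_exists_and_eq_and, hK]
  constructor
  · rintro ⟨⟨x, y⟩, ⟨⟨hx, hy, hxK, hyK⟩, hc⟩, rfl⟩
    exact ⟨x, by simpa using hx, y, by simpa using hy, hxK, hyK, hc, (ratPoint_point _ _ _).symm⟩
  · rintro ⟨x, hx, y, hy, hxK, hyK, hc, rfl⟩
    exact ⟨(x, y), ⟨⟨by simpa using hx, by simpa using hy, hxK, hyK⟩, hc⟩, ratPoint_point _ _ _⟩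

theorem mem_blue_iff (hK : i.2 = K.toQuad) (p : ℝ × ℝ) : p ∈ i.sbccInstance.blue ↔
    ∃ x ∈ i.xCoords.toFinset, ∃ y ∈ i.yCoords.toFinset, x < K.right ∧ y < K.top ∧ ¬ i.inside x y ∧
      rankPoint i.xCoords.toFinset i.yCoords.toFinset x y = p := by
  simp only [sbccInstance, points, Finset.mem_image, List.mem_toFinset, List.mem_map,
    List.mem_filter, mem_cells, exists_exists_and_eq_and, hK]
  constructor
  · rintro ⟨⟨x, y⟩, ⟨⟨hx, hy, hxK, hyK⟩, hc⟩, rfl⟩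
    exact ⟨x, by simpa using hx, y, by simpa using hy, hxK, hyK, by simpa using hc,
      (ratPoint_point _ _ _).symm⟩
  · rintro ⟨x, hx, y, hy, hxK, hyK, hc, rfl⟩
    exact ⟨(x, y), ⟨⟨by simpa using hx, by simpa using hy, hxK, hyK⟩, by simpa using hc⟩,
      ratPoint_point _ _ _⟩

open Classical in
theorem Describes.exists_output (h : i.Describes P K) {Z : Finset (Box ℝ)}
    (hlZ : ∀ b, b ∈ Z ↔ ∃ a ∈ l, a.toReal = b) (hZ : IsSBCC i.sbccInstance Z) :
    ∃ R B : Finset (Box ℝ), EncodesBoxes (enc (i.output (l.map Box.toQuad)).1) R ∧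
      EncodesBoxes (enc (i.output (l.map Box.toQuad)).2) B ∧ CoversExactly R P ∧
      CoversExactly B (K.toReal.toSet \ P) ∧ (R ∪ B).card ≤ Z.card := by
  have hlZ' : ∀ b ∈ l, b.toReal ∈ Z := fun b hb => (hlZ _).2 ⟨b, hb, rfl⟩
  have hred := mem_red_iff h.box
  have hblue := mem_blue_iff h.box
  have hcov : ∀ p, p ∈ i.sbccInstance.red ∨ p ∈ i.sbccInstance.blue →
      ∃ b ∈ l, b.toReal.CoversPoint p := by
    intro p hp
    obtain ⟨b, hb, hbp⟩ := hZ.covers p hp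
    obtain ⟨a, ha, rfl⟩ := (hlZ b).1 hb
    exact ⟨a, ha, hbp⟩
  have hmono : ∀ b ∈ l, ∀ p ∈ i.sbccInstance.red, ∀ p' ∈ i.sbccInstance.blue,
      b.toReal.CoversPoint p → ¬ b.toReal.CoversPoint p' := fun b hb p hp p' hp' hbp hbp' =>
    (hZ.monochromatic _ (hlZ' b hb)).elim (fun h => h p' hp' hbp') fun h => h p hp hbp
  obtain ⟨R, hRenc, hR, hR'⟩ := exists_encodesBoxes_of_isCellUnion (l := l) h.box h.isGrid.1
    h.isGrid.2 h.isCellUnion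
    (fun x hx y hy hxK hyK hc => hcov _ (.inl ((hred _).2 ⟨x, hx, y, hy, hxK, hyK, hc, rfl⟩)))
    fun b hb x hx y hy hxK hyK hbc hc x' hx' y' hy' hxK' hyK' hbc' => by
      by_contra hc'
      exact hmono b hb _ ((hred _).2 ⟨x, hx, y, hy, hxK, hyK, hc, rfl⟩) _
        ((hblue _).2 ⟨x', hx', y', hy', hxK', hyK', hc', rfl⟩) hbc hbc'
  have hA' : IsCellUnion i.xCoords.toFinset i.yCoords.toFinset K (closure (K.toReal.toSet \ P))
      fun x y => (!i.inside x y) = true := by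
    simpa using h.isCellUnion_compl
  obtain ⟨B, hBenc, hB, hB'⟩ := exists_encodesBoxes_of_isCellUnion (l := l) h.box h.isGrid.1
    h.isGrid.2 hA'
    (fun x hx y hy hxK hyK hc => hcov _ (.inr ((hblue _).2
      ⟨x, hx, y, hy, hxK, hyK, by simpa using hc, rfl⟩)))
    fun b hb x hx y hy hxK hyK hbc hc x' hx' y' hy' hxK' hyK' hbc' => by
      by_contra hc'
      exact hmono b hb _ ((hred _).2 ⟨x', hx', y', hy', hxK', hyK', by simpa using hc', rfl⟩) _
        ((hblue _).2 ⟨x, hx, y, hy, hxK, hyK, by simpa using hc, rfl⟩) hbc' hbc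
  refine ⟨R, B, hRenc, hBenc, ?_, hB, ?_⟩
  · rw [CoversExactly, h.isClosed.closure_eq, hR]
  · refine Finset.card_le_card_of_forall_subsingleton (fun r z => ∃ b q : Box ℚ, b.toReal = z ∧
      q.toReal = r ∧ q.toQuad = i.round b.toQuad) ?_ ?_
    · intro r hr
      obtain ⟨b, hb, q, hq, hbq⟩ := (Finset.mem_union.1 hr).elim (hR' r) (hB' r)
      exact ⟨_, hlZ' b hb, b, q, rfl, hq, hbq⟩
    · rintro z - r ⟨-, b, q, rfl, rfl, hq⟩ r' ⟨-, b', q', hb, rfl, hq'⟩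
      obtain rfl := Box.toReal_injective hb
      rw [Box.toQuad_injective (hq.trans hq'.symm)]

end PolygonData

theorem mainTheorem3 (ε : ℝ) (hε : 0 ≤ ε)
    (h : SBCC.PolyTimeApproximable (1 + ε)) : SRPC.PolyTimeApproximable (1 + ε) := by
  classical
  refine h.of_reduction (by linarith) PolygonData.polyTime_points PolygonData.polyTime_output ?_
  rintro I d ⟨dP, K, rfl, ⟨l, rfl, hpar, hfr⟩, hK⟩
  have hdes : PolygonData.Describes (l, K.toQuad) I.P K := by
    -- The representation as a union of boxes supplies the regularity of `P`.
    obtain ⟨Z, hZ, -⟩ := I.polygon.union_of_boxes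
    rw [I.closed.closure_eq] at hZ
    exact ⟨rfl, hpar, hfr, I.closed, hK ▸ I.subset, subset_closure_interior_of_eq_iUnion hZ⟩
  refine ⟨(l, K.toQuad), rfl, PolygonData.sbccInstance (l, K.toQuad), ?_, ?_, ?_⟩
  · exact ⟨_, _, rfl, ⟨_, rfl, by simp [PolygonData.sbccInstance]⟩,
      ⟨_, rfl, by simp [PolygonData.sbccInstance]⟩⟩
  · rintro ⟨R, B⟩ ⟨hR, hB⟩
    refine ⟨_, isSBCC_image_rankBox hdes.isGrid.1 hdes.isGrid.2 hdes.isCellUnion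
      hdes.isCellUnion_compl (PolygonData.mem_red_iff rfl) (PolygonData.mem_blue_iff rfl)
      (R := R) (B := B) ?_ ?_, ?_⟩
    · rw [← hR, I.closed.closure_eq]
    · rw [hK]; exact hB
    · exact Finset.card_image_le
  · rintro _ Z ⟨lZ, rfl, hlZ⟩ hZ
    obtain ⟨R, B, hRenc, hBenc, hR, hB, hcard⟩ := hdes.exists_output hlZ hZ
    exact ⟨lZ.map Box.toQuad, (enc_map_toQuad lZ).symm, (R, B), ⟨_, _, rfl, hRenc, hBenc⟩,
      ⟨hR, hK ▸ hB⟩, hcard⟩
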